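/- Let $\mathrm{Sp}(1)$ be the group of unit quaternions and $\mathrm{Sp}(2)$ the group of $2\times 2$ quaternionic matrices $g$ with $g^*g=gg^*=1$. It acts on the spinor space $\Delta=\mathbb{H}^2$ by left matrix multiplication, commuting with right multiplication by quaternions. For $v=(r,q)\in\mathbb{R}^5=\mathbb{R}\oplus\mathbb{H}$ put $c(v)=\begin{pmatrix} r & q\\ \bar q & -r\end{pmatrix}$, so that $c(v)^2=|v|^2$, and let $\rho:\mathrm{Sp}(2)\to\mathrm{SO}(5)$ be the spin double cover, $c(\rho(g)v)=g\,c(v)\,g^*$. Through $\rho$, $\mathrm{Sp}(2)$ acts on the unit sphere $S^4\subset\mathbb{R}^5$. Spinor fields on $S^4$ are smooth maps $\psi:S^4\to\Delta$, with Clifford multiplication $X\cdot\psi=c(X)c(x)\psi$ for $X\in T_xS^4$ and spin connection $\nabla_X\psi=\partial_X\psi-\tfrac12 c(X)c(x)\psi$. Fix $\kappa\in\{\tfrac12,-\tfrac12\}$; a Killing spinor is a $\psi$ with $\nabla_X\psi=\kappa X\cdot\psi$ for all tangent vectors $X$. For a finite subgroup $\Gamma<\mathrm{Sp}(2)$, the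 Killing spinors of the orbifold $S^4/\Gamma$ are those of $S^4$ with $\psi(\rho(\gamma)x)=\gamma\psi(x)$ for all $\gamma\in\Gamma$, $x\in S^4$. The orbifold $S^4/\Gamma$ is called supersymmetric if it has a nonzero Killing spinor, and (exactly) half-BPS if the real dimension of its space of Killing spinors is half that of $S^4$. Then, for every finite subgroup $\Gamma<\mathrm{Sp}(2)$: 1. The space of Killing spinors of $S^4$ is isomorphic, $\mathrm{Sp}(2)$-equivariantly, to $\Delta$. 2. $\dim_{\mathbb{H}}\Delta=2$, and the space $\Delta^\Gamma$ of $\Gamma$-invariant spinors is a (right) quaternionic subspace of $\Delta$. The space of Killing spinors of $S^4/\Gamma$ has real dimension $4\dim_{\mathbb{H}}\Delta^\Gamma$, and $S^4/\Gamma$ is half-BPS if and only if $\dim_{\mathbb{H}}\Delta^\Gamma=1$. 3. If $S^4/\Gamma$ is supersymmetric, then $\Gamma$ acts trivially on $S^4$ only if $\Gamma=\{1\}$ (so that the orbifold is $S^4$ itself), and otherwise $S^4/\Gamma$ is exactly half-BPS. 4. $S^4/\Gamma$ is half-BPS if and only if $\Gamma$ is conjugate in $\mathrm{Sp}(2)$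 to the image, under the embedding $u\mapsto\mathrm{diag}(u,1)$ of $\mathrm{Sp}(1)$ in $\mathrm{Sp}(2)$, of one of the ADE subgroups of $\mathrm{Sp}(1)$: the subgroups generated by - $e^{2\pi i/n}$, $n\ge 2$ ($\mathbb{A}_{n-1}$); - $j$ and $e^{i\pi/n}$, $n\ge2$ ($\mathbb{D}_{n+2}$); - $\frac{(1+i)(1+j)}{2}$ and $\frac{(1+j)(1+i)}{2}$ ($\mathbb{E}_6$); - $\frac{(1+i)(1+j)}{2}$ and $\frac{1+i}{\sqrt2}$ ($\mathbb{E}_7$); - $\frac{(1+i)(1+j)}{2}$ and $\frac{\phi+\phi^{-1}i+j}{2}$, $\phi=\frac{1+\sqrt5}{2}$ ($\mathbb{E}_8$). 5. The embedded $\mathrm{Sp}(1)$ acts on $\Delta=\mathbb{H}^2$ by $u\cdot(x,y)=(ux,y)$, and on $\mathbb{R}^5=\mathbb{R}\oplus\mathbb{H}$ by $u\cdot(r,q)=(r,uq)$: it fixes a vector and acts on its orthogonal complement $\mathbb{H}$ by left quaternion multiplication. -/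

import Mathlib

open scoped Quaternion Matrix

namespace M5

noncomputable section

/-! ## The groups, the spinor representation and the four-sphere -/

/-- `Sp(1)`, the group of unit quaternions. -/
abbrev Sp1 : Type := unitary ℍ[ℝ]

/-- `Sp(2)`, the group of `2 × 2` quaternionic matrices `g` with `g* g = g g* = 1`. -/
abbrev Sp2 : Type := unitary (Matrix (Fin 2) (Fin 2) ℍ[ℝ])

/-- The spinor module `Δ = ℍ²`. It is a right quaternionic vector space, that is, a module over
`ℍᵐᵒᵖ`, and `Sp(2)` acts on it by matrix multiplication from the left. -/
abbrev Spinor : Type := Fin 2 → ℍ[ℝ]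

/-- Euclidean `ℝ⁵`, written as `ℝ ⊕ ℍ`. -/
abbrev E5 : Type := WithLp 2 (ℝ × ℍ[ℝ])

/-- The round unit sphere `S⁴ ⊂ ℝ⁵`. -/
abbrev S4 : Type := Metric.sphere (0 : E5) 1

/-- Clifford multiplication of `ℝ⁵` on `Δ`: it identifies `ℝ⁵` with the trace-free hermitian
`2 × 2` quaternionic matrices, and squares to `|v|²`. -/
def cliff (v : E5) : Matrix (Fin 2) (Fin 2) ℍ[ℝ] :=
  !![((v.fst : ℝ) : ℍ[ℝ]), v.snd; star v.snd, -((v.fst : ℝ) : ℍ[ℝ])]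

theorem cliff_add (v w : E5) : cliff (v + w) = cliff v + cliff w := by
  ext i j <;> fin_cases i <;> fin_cases j <;> simp [cliff]
  ring

theorem cliff_smul (a : ℝ) (v : E5) : cliff (a • v) = a • cliff v := by
  ext i j <;> fin_cases i <;> fin_cases j <;> simp [cliff]

theorem cliff_sq (v : E5) : cliff v * cliff v = (‖v‖ ^ 2) • 1 := by
  have hn : ‖v‖ ^ 2 = v.fst ^ 2 + Quaternion.normSq v.snd := by
    rw [WithLp.prod_norm_sq_eq_of_L2, Quaternion.normSq_eq_norm_mul_self, Real.norm_eq_abs,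
      sq_abs, sq ‖v.snd‖]
  rw [hn]
  ext i j <;> fin_cases i <;> fin_cases j <;>
    simp [cliff, Matrix.mul_apply, Fin.sum_univ_two, Quaternion.normSq_def'] <;> ring

theorem cliff_injective : Function.Injective cliff := by
  intro v w h
  have h0 := congrFun (congrFun h 0) 0
  have h1 := congrFun (congrFun h 0) 1
  simp only [cliff, Matrix.of_apply, Matrix.cons_val', Matrix.cons_val_zero,
    Matrix.cons_val_one] at h0 h1
  apply (WithLp.equiv 2 (ℝ × ℍ[ℝ])).injective
  exact Prod.ext (Quaternion.coe_injective h0) h1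

/-- The vector `ρ(g) v` with `cliff (ρ(g) v) = g (cliff v) g*`. -/
def rhoFun (g : Sp2) (v : E5) : E5 :=
  WithLp.toLp 2
    (((g.1 * cliff v * star g.1) 0 0).re, (g.1 * cliff v * star g.1) 0 1)

theorem cliff_rhoFun (g : Sp2) (v : E5) :
    cliff (rhoFun g v) = g.1 * cliff v * star g.1 := by
  have hstar : star (cliff v) = cliff v := by
    ext i j <;> fin_cases i <;> fin_cases j <;> simp [cliff, Matrix.star_apply]
  obtain ⟨M, hM⟩ : ∃ M, M = g.1 * cliff v * star g.1 := ⟨_, rfl⟩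
  have hMs : star M = M := by
    rw [hM, star_mul, star_mul, star_star, hstar, mul_assoc]
  have hre : ∀ A B : Matrix (Fin 2) (Fin 2) ℍ[ℝ],
      ((A * B).trace).re = ((B * A).trace).re := by
    intro A B
    simp [Matrix.trace, Matrix.mul_apply, Fin.sum_univ_two]
    ring
  have htr : (M 0 0).re + (M 1 1).re = 0 := by
    have h := hre (g.1 * cliff v) (star g.1)
    rw [← mul_assoc, Unitary.star_mul_self_of_mem g.2, one_mul, ← hM] at h
    simpa [Matrix.trace, Fin.sum_univ_two, cliff] using h
  have h00 := congrFun (congrFun hMs 0) 0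
  have h10 := congrFun (congrFun hMs 1) 0
  have h11 := congrFun (congrFun hMs 1) 1
  rw [Matrix.star_apply] at h00 h10 h11
  have hc0 := Quaternion.star_eq_self.mp h00
  have hc1 := Quaternion.star_eq_self.mp h11
  rw [← hM]
  have hr : rhoFun g v = WithLp.toLp 2 ((M 0 0).re, M 0 1) := by rw [rhoFun, hM]
  rw [hr]
  ext1 i j
  fin_cases i <;> fin_cases j
  · simpa [cliff] using hc0.symm
  · simp [cliff]
  · simpa [cliff] using h10
  · have : -((M 0 0).re : ℍ[ℝ]) = M 1 1 := by
      rw [hc1, ← Quaternion.coe_neg]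
      congr 1
      linarith
    simpa [cliff] using this

/-- The spin double cover `ρ : Sp(2) → SO(5)`, `cliff (ρ(g) v) = g (cliff v) g⁻¹`. -/
def rho : Sp2 →* (E5 ≃ₗᵢ[ℝ] E5) where
  toFun g :=
    { toFun := rhoFun g
      invFun := rhoFun g⁻¹
      map_add' := fun v w => cliff_injective (by
        simp only [cliff_rhoFun, cliff_add, mul_add, add_mul])
      map_smul' := fun a v => cliff_injective (by
        simp only [cliff_rhoFun, cliff_smul, RingHom.id_apply, Matrix.mul_smul, Matrix.smul_mul])
      left_inv := fun v => cliff_injective (by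
        have h := Unitary.star_mul_self_of_mem g.2
        have hi : (g⁻¹).1 = star g.1 := rfl
        simp only [cliff_rhoFun, hi, star_star]
        calc star g.1 * (g.1 * cliff v * star g.1) * g.1
            = (star g.1 * g.1) * cliff v * (star g.1 * g.1) := by simp only [mul_assoc]
          _ = cliff v := by rw [h, one_mul, mul_one])
      right_inv := fun v => cliff_injective (by
        have h := Unitary.mul_star_self_of_mem g.2
        have hi : (g⁻¹).1 = star g.1 := rfl
        simp only [cliff_rhoFun, hi, star_star]
        calc g.1 * (star g.1 * cliff v * g.1) * star g.1
            = (g.1 * star g.1) * cliff v * (g.1 * star g.1) := by simp only [mul_assoc]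
          _ = cliff v := by rw [h, one_mul, mul_one])
      norm_map' := fun v => by
        have h := Unitary.star_mul_self_of_mem g.2
        have h2 := Unitary.mul_star_self_of_mem g.2
        have e : cliff (rhoFun g v) * cliff (rhoFun g v) = (‖v‖ ^ 2) • 1 := by
          rw [cliff_rhoFun]
          calc g.1 * cliff v * star g.1 * (g.1 * cliff v * star g.1)
              = g.1 * (cliff v * ((star g.1 * g.1) * cliff v)) * star g.1 := by
                simp only [mul_assoc]
            _ = (‖v‖ ^ 2) • 1 := by
                rw [h, one_mul, cliff_sq, Matrix.mul_smul, mul_one, Matrix.smul_mul, h2]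
        rw [cliff_sq] at e
        have e0 := congrArg QuaternionAlgebra.re (congrFun (congrFun e 0) 0)
        simp at e0
        exact (sq_eq_sq₀ (norm_nonneg _) (norm_nonneg _)).mp (by simpa using e0) }
  map_one' := LinearIsometryEquiv.ext fun v => cliff_injective (by
    change cliff (rhoFun 1 v) = cliff v
    simp [cliff_rhoFun])
  map_mul' g h := LinearIsometryEquiv.ext fun v => cliff_injective (by
    change cliff (rhoFun (g * h) v) = cliff (rhoFun g (rhoFun h v))
    simp only [cliff_rhoFun, Submonoid.coe_mul, star_mul, mul_assoc])

/-- The action of `Sp(2)` on `S⁴` through `ρ`. -/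
def sphereAct (g : Sp2) (x : S4) : S4 :=
  ⟨rho g x.1, by
    rw [mem_sphere_zero_iff_norm, LinearIsometryEquiv.norm_map]
    exact mem_sphere_zero_iff_norm.mp x.2⟩

/-! ## Killing spinors

The spinor bundle of `S⁴` is the restriction of the trivial bundle `ℝ⁵ × Δ`, so spinor fields are
functions `S⁴ → Δ`. With `ν = x` the unit normal, a tangent vector `X` acts by
`X · ψ = cliff X (cliff x ψ)` (so `X · X · ψ = -|X|² ψ`), and the Levi-Civita spin connection is
`∇_X ψ = ∂_X ψ - ½ cliff X (cliff x ψ)`. -/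

/-- The extension of a spinor field on `S⁴` to `ℝ⁵ ∖ {0}` that is constant along rays
(with value `0` at the origin). -/
def radialExt (ψ : S4 → Spinor) (x : E5) : Spinor :=
  open Classical in
  if h : x = 0 then 0
  else ψ ⟨‖x‖⁻¹ • x, by
    rw [mem_sphere_zero_iff_norm, norm_smul, norm_inv, norm_norm,
      inv_mul_cancel₀ (norm_ne_zero_iff.mpr h)]⟩

/-- A spinor field on `S⁴` is smooth. -/
def IsSmoothSpinor (ψ : S4 → Spinor) : Prop :=
  ContDiffOn ℝ (⊤ : ℕ∞) (radialExt ψ) {0}ᶜ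

/-- Clifford multiplication of the tangent vector `X ∈ T_x S⁴` on spinors at `x`. -/
def sphereCliff (x : S4) (X : E5) (s : Spinor) : Spinor :=
  cliff X *ᵥ (cliff x.1 *ᵥ s)

/-- The spin covariant derivative on `S⁴` at `x` in the direction `X ∈ T_x S⁴`. -/
def spinCovDeriv (ψ : S4 → Spinor) (x : S4) (X : E5) : Spinor :=
  fderiv ℝ (radialExt ψ) x.1 X - (1 / 2 : ℝ) • sphereCliff x X (ψ x)

/-- `ψ` is a (real) Killing spinor on `S⁴` with Killing constant `κ`:
`∇_X ψ = κ X · ψ` for all tangent vectors `X`. -/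
def IsKillingSpinor (κ : ℝ) (ψ : S4 → Spinor) : Prop :=
  IsSmoothSpinor ψ ∧
    ∀ (x : S4) (X : E5), inner ℝ x.1 X = 0 →
      spinCovDeriv ψ x X = κ • sphereCliff x X (ψ x)

theorem radialExt_add (ψ φ : S4 → Spinor) :
    radialExt (ψ + φ) = radialExt ψ + radialExt φ := by
  funext x
  by_cases h : x = 0 <;> simp [radialExt, h]

theorem radialExt_smul (a : ℝ) (ψ : S4 → Spinor) :
    radialExt (a • ψ) = a • radialExt ψ := by
  funext x
  by_cases h : x = 0 <;> simp [radialExt, h]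

theorem IsSmoothSpinor.differentiableAt {ψ : S4 → Spinor} (h : IsSmoothSpinor ψ) (x : S4) :
    DifferentiableAt ℝ (radialExt ψ) x.1 := by
  have hx : x.1 ≠ 0 := ne_zero_of_mem_unit_sphere x
  exact (h.contDiffAt (isOpen_compl_singleton.mem_nhds hx)).differentiableAt (by simp)

/-- The real vector space of Killing spinors on `S⁴` with Killing constant `κ`. -/
def killingSpinors (κ : ℝ) : Submodule ℝ (S4 → Spinor) where
  carrier := {ψ | IsKillingSpinor κ ψ}
  zero_mem' := by
    have h0 : radialExt (0 : S4 → Spinor) = fun _ => 0 := by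
      funext x
      by_cases h : x = 0 <;> simp [radialExt, h]
    refine ⟨by rw [IsSmoothSpinor, h0]; exact contDiffOn_const, fun x X _ => ?_⟩
    simp [spinCovDeriv, sphereCliff, h0]
  add_mem' := by
    rintro ψ φ ⟨h1, h2⟩ ⟨k1, k2⟩
    refine ⟨by rw [IsSmoothSpinor, radialExt_add]; exact h1.add k1, fun x X hX => ?_⟩
    have a := h2 x X hX
    have b := k2 x X hX
    simp only [spinCovDeriv, sphereCliff] at a b ⊢
    rw [radialExt_add, fderiv_add (h1.differentiableAt x) (k1.differentiableAt x)]
    simp only [Pi.add_apply, Matrix.mulVec_add, smul_add, add_apply]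
    rw [← a, ← b]
    abel
  smul_mem' := by
    rintro c ψ ⟨h1, h2⟩
    refine ⟨by rw [IsSmoothSpinor, radialExt_smul]; exact h1.const_smul c, fun x X hX => ?_⟩
    have a := h2 x X hX
    simp only [spinCovDeriv, sphereCliff] at a ⊢
    rw [radialExt_smul, fderiv_const_smul (h1.differentiableAt x)]
    simp only [Pi.smul_apply, Matrix.mulVec_smul, smul_apply]
    rw [smul_comm κ c, ← a, smul_sub, smul_comm c (1 / 2 : ℝ)]

/-- The Killing spinors of the spin orbifold `S⁴/Γ`: the Killing spinors `ψ` on `S⁴` that are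
invariant under `(γ · ψ)(x) = γ ψ(γ⁻¹ x)`, `γ ∈ Γ`. -/
def orbifoldKillingSpinors (κ : ℝ) (Γ : Subgroup Sp2) : Submodule ℝ (S4 → Spinor) where
  carrier := {ψ | ψ ∈ killingSpinors κ ∧ ∀ γ ∈ Γ, ∀ x, ψ (sphereAct γ x) = γ.1 *ᵥ ψ x}
  zero_mem' := ⟨Submodule.zero_mem _, fun γ _ x => by simp⟩
  add_mem' := by
    rintro ψ φ ⟨h1, h2⟩ ⟨k1, k2⟩
    exact ⟨Submodule.add_mem _ h1 k1, fun γ hγ x => by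
      simp [h2 γ hγ x, k2 γ hγ x, Matrix.mulVec_add]⟩
  smul_mem' := by
    rintro c ψ ⟨h1, h2⟩
    exact ⟨Submodule.smul_mem _ c h1, fun γ hγ x => by
      simp [h2 γ hγ x, Matrix.mulVec_smul]⟩

/-- The real vector space `Δ^Γ` of `Γ`-invariant spinors. -/
def invariantSpinors (Γ : Subgroup Sp2) : Submodule ℝ Spinor where
  carrier := {s | ∀ γ ∈ Γ, γ.1 *ᵥ s = s}
  zero_mem' := fun γ _ => by simp
  add_mem' := fun {s t} hs ht γ hγ => by rw [Matrix.mulVec_add, hs γ hγ, ht γ hγ]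
  smul_mem' := fun c s hs γ hγ => by rw [Matrix.mulVec_smul, hs γ hγ]

/-- The orbifold `S⁴/Γ` is supersymmetric: it admits a nonzero Killing spinor. -/
def IsSupersymmetric (κ : ℝ) (Γ : Subgroup Sp2) : Prop :=
  orbifoldKillingSpinors κ Γ ≠ ⊥

/-- The orbifold `S⁴/Γ` is (exactly) half-BPS: the space of its Killing spinors has half the
dimension of the space of Killing spinors of `S⁴`. -/
def IsHalfBPS (κ : ℝ) (Γ : Subgroup Sp2) : Prop :=
  2 * Module.finrank ℝ (orbifoldKillingSpinors κ Γ) = Module.finrank ℝ (killingSpinors κ)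

/-! ## The ADE subgroups of `Sp(1)` -/

theorem mem_Sp1 (q : ℍ[ℝ]) (h : q.re ^ 2 + q.imI ^ 2 + q.imJ ^ 2 + q.imK ^ 2 = 1) :
    q ∈ unitary ℍ[ℝ] := by
  have hn : Quaternion.normSq q = 1 := by rw [Quaternion.normSq_def', h]
  refine Unitary.mem_iff.mpr ⟨?_, ?_⟩
  · rw [Quaternion.star_mul_self, hn, Quaternion.coe_one]
  · rw [Quaternion.self_mul_star, hn, Quaternion.coe_one]

/-- The unit quaternion `a + b i + c j + d k`. -/
def unitQuat (a b c d : ℝ) (h : a ^ 2 + b ^ 2 + c ^ 2 + d ^ 2 = 1) : Sp1 :=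
  ⟨⟨a, b, c, d⟩, mem_Sp1 _ h⟩

/-- `e^{iθ} = cos θ + i sin θ`. -/
def expI (θ : ℝ) : Sp1 := unitQuat (Real.cos θ) (Real.sin θ) 0 0 (by simp)

/-- The quaternion `j`. -/
def quatJ : Sp1 := unitQuat 0 0 1 0 (by norm_num)

/-- `(1 + i)(1 + j) / 2 = (1 + i + j + k) / 2`. -/
def quatS : Sp1 := unitQuat (1 / 2) (1 / 2) (1 / 2) (1 / 2) (by norm_num)

/-- `(1 + j)(1 + i) / 2 = (1 + i + j - k) / 2`. -/
def quatS' : Sp1 := unitQuat (1 / 2) (1 / 2) (1 / 2) (-1 / 2) (by norm_num)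

/-- `(1 + i) / √2`. -/
def quatO : Sp1 := unitQuat (1 / √2) (1 / √2) 0 0 (by norm_num [div_pow])

/-- `(φ + φ⁻¹ i + j) / 2`, with `φ = (1 + √5) / 2` the golden ratio. -/
def quatI : Sp1 := unitQuat (Real.goldenRatio / 2) (Real.goldenRatio⁻¹ / 2) (1 / 2) 0 (by
  rw [Real.inv_goldenRatio]
  have h1 := Real.goldenRatio_sq
  have h2 := Real.goldenConj_sq
  have h3 := Real.goldenRatio_add_goldenConj
  nlinarith)

/-- The ADE subgroups of `Sp(1)`. These are explicit subgroups, not conjugacy classes: `𝔸_{n-1}`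
(cyclic of order `n`) and `𝔻_{n+2}` (binary dihedral of order `4n`) for `n ≥ 2`, and the binary
tetrahedral, octahedral and icosahedral groups `𝔼₆`, `𝔼₇`, `𝔼₈`. -/
inductive IsADE : Subgroup Sp1 → Prop
  | A (n : ℕ) (hn : 2 ≤ n) : IsADE (Subgroup.closure {expI (2 * Real.pi / n)})
  | D (n : ℕ) (hn : 2 ≤ n) : IsADE (Subgroup.closure {quatJ, expI (Real.pi / n)})
  | E6 : IsADE (Subgroup.closure {quatS, quatS'})
  | E7 : IsADE (Subgroup.closure {quatS, quatO})
  | E8 : IsADE (Subgroup.closure {quatS, quatI})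

/-- The embedding `Sp(1) → Sp(2)`, `u ↦ diag(u, 1)`. -/
def embed : Sp1 →* Sp2 where
  toFun u := ⟨Matrix.diagonal ![u.1, 1], by
    have h1 := Unitary.star_mul_self_of_mem u.2
    have h2 := Unitary.mul_star_self_of_mem u.2
    rw [Unitary.mem_iff]
    constructor <;> ext1 i j <;> fin_cases i <;> fin_cases j <;>
      simp [Matrix.star_eq_conjTranspose, Matrix.diagonal_conjTranspose, h1, h2]⟩
  map_one' := Subtype.ext (by
    ext1 i j
    fin_cases i <;> fin_cases j <;> simp)
  map_mul' u v := Subtype.ext (by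
    ext1 i j
    fin_cases i <;> fin_cases j <;> simp [Matrix.diagonal_mul_diagonal])

end

end M5

/-!
A Killing spinor satisfies `∂_X ψ = (κ + 1/2) X · ψ`. For `κ = -1/2` it is constant, and for
`κ = 1/2` the Clifford product `cliff x (ψ x)` is constant: in both cases the derivative along every
great circle vanishes, and any two points lie on a great circle
(`IsKillingSpinor.eq_killingField`). So `Δ` parametrises the Killing spinors, equivariantly, and
the Killing spinors of `S⁴/Γ` correspond to `Δ^Γ` (`orbifoldKillingSpinors_eq_map`). As `Δ^Γ` is a
quaternionic subspace of the plane `Δ`, the orbifold is half-BPS exactly when `Γ` is nontrivial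
and fixes a nonzero spinor (`isHalfBPS_iff`). `Sp(2)` is transitive on quaternionic lines and the
stabiliser of `(0, 1)` is the embedded `Sp(1)`, so `Γ` is conjugate to a finite subgroup of `Sp(1)`
(`exists_eq_conj_embed`).

It remains to classify the finite subgroups `G` of `Sp(1)` (`exists_conj_isADE`). The argument is
metric and counts no orbits. Suppose first that `-1 ∈ G`. Finite subgroups of a circle consist of
roots of unity, so the largest real part below `1` in `G` is `cos (π / n)` for some `n`
(`exists_max_re`), and after conjugation `a = exp (iπ / n)` is in `G`. Write `b = z + w j` for
an element of `G`. The commutator `a b a⁻¹ b⁻¹` has real part `1 - 2 sin² (π / n) |w|²`, and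
replacing `b` by `b a b⁻¹` replaces `|w|²` by `4 sin² (π / n) |w|² |z|²`. As in Jørgensen's inequality
for Kleinian groups, the maximality of `cos (π / n)` then forces `z w = 0` for all `b` if `n ≥ 6`
(`IsNormalPosition.offCircle_of_six_le`), and the same holds for `n = 2`; a group with this
property is cyclic or binary dihedral (`IsNormalPosition.cyclic_or_dihedral`). For `n = 3, 4, 5`
only finitely many real parts are possible, and if some `z w` is nonzero, they force the existence
of `b` with `Re b = 1/2` and `Re (ab) = 0`. A pair `(a, b)` is determined up to conjugation by the
real parts of `a`, `b` and `ab` (`exists_conj_pair`), so after conjugation `G` contains the binary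
polyhedral group `E` of the same `n`. Finally `G = E`: an element `y` of maximal real part in its
coset of `E` has real part above `cos (π / n)`, because the points of `E` are dense enough in the
`3`-sphere, and hence is `1` (`le_closure_E6`, `le_closure_E7`, `le_closure_E8`).

If `-1 ∉ G`, the group `±G` is conjugate into a circle, since otherwise it contains a square root of
`-1`, and then so does `G`.
-/

/-! ### Unit quaternions in coordinates -/

namespace M5

open scoped Pointwise

theorem coe_inv_Sp1 (x : Sp1) : ((x⁻¹ : Sp1) : ℍ[ℝ]) = star x.1 := rfl

theorem coe_mul_Sp1 (x y : Sp1) : ((x * y : Sp1) : ℍ[ℝ]) = x.1 * y.1 := rfl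

theorem Sp1_ext {x y : Sp1} (h0 : x.1.re = y.1.re) (h1 : x.1.imI = y.1.imI)
    (h2 : x.1.imJ = y.1.imJ) (h3 : x.1.imK = y.1.imK) : x = y :=
  Subtype.ext (Quaternion.ext _ _ h0 h1 h2 h3)

theorem sum_sq_Sp1 (x : Sp1) :
    x.1.re ^ 2 + x.1.imI ^ 2 + x.1.imJ ^ 2 + x.1.imK ^ 2 = 1 := by
  have h := Unitary.star_mul_self_of_mem x.2
  rw [Quaternion.star_mul_self, ← Quaternion.coe_one] at h
  rw [← Quaternion.normSq_def', Quaternion.coe_injective h]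

/-- The quaternion `a + b i + c j + d k`. -/
def quat (a b c d : ℝ) : ℍ[ℝ] := ⟨a, b, c, d⟩

@[simp] theorem quat_re (a b c d : ℝ) : (quat a b c d).re = a := rfl
@[simp] theorem quat_imI (a b c d : ℝ) : (quat a b c d).imI = b := rfl
@[simp] theorem quat_imJ (a b c d : ℝ) : (quat a b c d).imJ = c := rfl
@[simp] theorem quat_imK (a b c d : ℝ) : (quat a b c d).imK = d := rfl

theorem coe_unitQuat (a b c d : ℝ) (h) : (unitQuat a b c d h).1 = quat a b c d := rfl

theorem coe_neg_Sp1 (x : Sp1) : ((-x : Sp1) : ℍ[ℝ]) = -x.1 := rfl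

theorem re_le_one (x : Sp1) : x.1.re ≤ 1 := by
  nlinarith [sum_sq_Sp1 x, sq_nonneg x.1.imI, sq_nonneg x.1.imJ, sq_nonneg x.1.imK,
    sq_nonneg (x.1.re - 1)]

theorem eq_one_of_re_eq_one {x : Sp1} (h : x.1.re = 1) : x = 1 := by
  have hs := sum_sq_Sp1 x
  rw [h] at hs
  have h1 : x.1.imI = 0 := by
    apply pow_eq_zero_iff (two_ne_zero) |>.mp
    nlinarith [sq_nonneg x.1.imI, sq_nonneg x.1.imJ, sq_nonneg x.1.imK]
  have h2 : x.1.imJ = 0 := by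
    apply pow_eq_zero_iff (two_ne_zero) |>.mp
    nlinarith [sq_nonneg x.1.imI, sq_nonneg x.1.imJ, sq_nonneg x.1.imK]
  have h3 : x.1.imK = 0 := by
    apply pow_eq_zero_iff (two_ne_zero) |>.mp
    nlinarith [sq_nonneg x.1.imI, sq_nonneg x.1.imJ, sq_nonneg x.1.imK]
  exact Sp1_ext (by simpa using h) (by simpa using h1) (by simpa using h2) (by simpa using h3)

theorem re_mul_comm (x y : Sp1) : (x * y).1.re = (y * x).1.re := by
  simp only [coe_mul_Sp1, Quaternion.re_mul]; ring

theorem re_conj (h x : Sp1) : (h * x * h⁻¹).1.re = x.1.re := by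
  rw [re_mul_comm, inv_mul_cancel_left]

theorem expI_add (s t : ℝ) : expI (s + t) = expI s * expI t := by
  apply Sp1_ext <;> simp [expI, coe_unitQuat, Real.cos_add, Real.sin_add]
  ring

theorem expI_zero : expI 0 = 1 := by
  apply Sp1_ext <;> simp [expI, coe_unitQuat]

theorem expI_nat_mul (k : ℕ) (t : ℝ) : expI (k * t) = expI t ^ k := by
  induction k with
  | zero => simp [expI_zero]
  | succ k ih => rw [pow_succ, ← ih, ← expI_add]; congr 1; push_cast; ring

theorem expI_inv (t : ℝ) : (expI t)⁻¹ = expI (-t) := by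
  rw [inv_eq_iff_mul_eq_one, ← expI_add, add_neg_cancel, expI_zero]

theorem expI_pi : expI Real.pi = -1 := by
  apply Sp1_ext <;> simp [expI, coe_unitQuat, coe_neg_Sp1]

theorem exists_unit_smul {q : ℍ[ℝ]} (hq : q ≠ 0) : ∃ (h : Sp1) (r : ℝ), r ≠ 0 ∧ h.1 = r • q := by
  have hn : 0 < Quaternion.normSq q := by
    rcases (Quaternion.normSq_nonneg (a := q)).lt_or_eq with h | h
    · exact h
    · exact absurd (Quaternion.normSq_eq_zero.mp h.symm) hq
  have hs := Real.sq_sqrt hn.le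
  have hp := Real.sqrt_pos.mpr hn
  refine ⟨⟨(√(Quaternion.normSq q))⁻¹ • q, mem_Sp1 _ ?_⟩, _, (inv_pos.mpr hp).ne', rfl⟩
  have e := Quaternion.normSq_def' (a := q)
  simp only [Quaternion.re_smul, Quaternion.imI_smul, Quaternion.imJ_smul, Quaternion.imK_smul,
    smul_eq_mul, mul_pow, inv_pow, hs, ← mul_add]
  rw [← e, inv_mul_cancel₀ hn.ne']

/-- Two unit quaternions intertwined by a nonzero quaternion are conjugate by a unit one. -/
theorem exists_conj_of_intertwine {q : ℍ[ℝ]} (hq : q ≠ 0) :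
    ∃ h : Sp1, ∀ x y : Sp1, q * x.1 = y.1 * q → h * x * h⁻¹ = y := by
  obtain ⟨h, r, -, hr⟩ := exists_unit_smul hq
  refine ⟨h, fun x y e => mul_inv_eq_iff_eq_mul.mpr (Subtype.ext ?_)⟩
  rw [coe_mul_Sp1, coe_mul_Sp1, hr, smul_mul_assoc, e, mul_smul_comm]

/-- Every unit quaternion is conjugate to one in the circle of the `expI θ`, with nonnegative
`i`-component. -/
theorem exists_conj_circle (x : Sp1) :
    ∃ h : Sp1, (h * x * h⁻¹).1.imJ = 0 ∧ (h * x * h⁻¹).1.imK = 0 ∧ 0 ≤ (h * x * h⁻¹).1.imI := by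
  obtain ⟨r, hr0, hr⟩ : ∃ r : ℝ, 0 ≤ r ∧ r ^ 2 = x.1.imI ^ 2 + x.1.imJ ^ 2 + x.1.imK ^ 2 :=
    ⟨_, Real.sqrt_nonneg _, Real.sq_sqrt (by positivity)⟩
  have hs := sum_sq_Sp1 x
  have key : ∀ q : ℍ[ℝ], q ≠ 0 →
      q * x.1 = quat x.1.re r 0 0 * q → ∃ h : Sp1,
        (h * x * h⁻¹).1.imJ = 0 ∧ (h * x * h⁻¹).1.imK = 0 ∧ 0 ≤ (h * x * h⁻¹).1.imI := by
    intro q hq e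
    obtain ⟨h, hh⟩ := exists_conj_of_intertwine hq
    have := hh x (unitQuat x.1.re r 0 0 (by rw [hr]; linarith)) e
    exact ⟨h, by rw [this]; exact ⟨rfl, rfl, hr0⟩⟩
  -- `r - i Im x` intertwines, unless it vanishes, in which case `j` does
  by_cases h0 : quat (r + x.1.imI) 0 x.1.imK (-x.1.imJ) = 0
  · have e0 : r + x.1.imI = 0 := congrArg QuaternionAlgebra.re h0
    have e2 : x.1.imK = 0 := congrArg QuaternionAlgebra.imJ h0
    have e3 : -x.1.imJ = 0 := congrArg QuaternionAlgebra.imK h0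
    refine key (quat 0 0 1 0) (fun h => one_ne_zero (congrArg QuaternionAlgebra.imJ h)) ?_
    ext <;> simp <;> linarith
  · refine key _ h0 ?_
    ext <;> simp [Quaternion.re_mul, Quaternion.imI_mul, Quaternion.imJ_mul,
      Quaternion.imK_mul] <;> nlinarith

/-- If `a` lies in the standard circle, then conjugation within that circle rotates the `j`- and
`k`-components of `b`, so the `k`-component can be made to vanish. -/
theorem exists_conj_pair_normal (a b : Sp1) (hJ : a.1.imJ = 0) (hK : a.1.imK = 0) :
    ∃ h : Sp1, h * a * h⁻¹ = a ∧ (h * b * h⁻¹).1.imK = 0 ∧ 0 ≤ (h * b * h⁻¹).1.imJ ∧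
      (h * b * h⁻¹).1.imI = b.1.imI := by
  obtain ⟨r, hr0, hr⟩ : ∃ r : ℝ, 0 ≤ r ∧ r ^ 2 = b.1.imJ ^ 2 + b.1.imK ^ 2 :=
    ⟨_, Real.sqrt_nonneg _, Real.sq_sqrt (by positivity)⟩
  have hs := sum_sq_Sp1 b
  have key : ∀ q : ℍ[ℝ], q ≠ 0 → q.imJ = 0 → q.imK = 0 →
      q * b.1 = quat b.1.re b.1.imI r 0 * q → ∃ h : Sp1, h * a * h⁻¹ = a ∧
        (h * b * h⁻¹).1.imK = 0 ∧ 0 ≤ (h * b * h⁻¹).1.imJ ∧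
        (h * b * h⁻¹).1.imI = b.1.imI := by
    intro q hq q2 q3 e
    obtain ⟨h, hh⟩ := exists_conj_of_intertwine hq
    have := hh b (unitQuat b.1.re b.1.imI r 0 (by rw [hr]; linarith)) e
    refine ⟨h, hh a a ?_, by rw [this]; exact ⟨rfl, hr0, rfl⟩⟩
    ext <;> simp [Quaternion.re_mul, Quaternion.imI_mul, Quaternion.imJ_mul,
      Quaternion.imK_mul, hJ, hK, q2, q3] <;> ring
  -- `(r + b_J) - b_K i` intertwines, unless it vanishes, in which case `i` does
  by_cases h0 : quat (r + b.1.imJ) (-b.1.imK) 0 0 = 0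
  · have e0 : r + b.1.imJ = 0 := congrArg QuaternionAlgebra.re h0
    have e1 : -b.1.imK = 0 := congrArg QuaternionAlgebra.imI h0
    refine key (quat 0 1 0 0) (fun h => one_ne_zero (congrArg QuaternionAlgebra.imI h)) rfl rfl ?_
    ext <;> simp <;> linarith
  · refine key _ h0 rfl rfl ?_
    ext <;> simp [Quaternion.re_mul, Quaternion.imI_mul, Quaternion.imJ_mul,
      Quaternion.imK_mul] <;> nlinarith

/-- A pair `(a, b)` of unit quaternions, `a ≠ ±1`, is determined up to simultaneous conjugation by
the real parts of `a`, `b` and `ab`. -/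
theorem exists_conj_pair {a b a' b' : Sp1} (ha : a.1.re ^ 2 ≠ 1) (h1 : a.1.re = a'.1.re)
    (h2 : b.1.re = b'.1.re) (h3 : (a * b).1.re = (a' * b').1.re) :
    ∃ h : Sp1, h * a * h⁻¹ = a' ∧ h * b * h⁻¹ = b' := by
  have normal : ∀ x y : Sp1, ∃ h : Sp1, (h * x * h⁻¹).1.imJ = 0 ∧ (h * x * h⁻¹).1.imK = 0 ∧
      0 ≤ (h * x * h⁻¹).1.imI ∧ (h * y * h⁻¹).1.imK = 0 ∧ 0 ≤ (h * y * h⁻¹).1.imJ := by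
    intro x y
    obtain ⟨h, k1, k2, k3⟩ := exists_conj_circle x
    obtain ⟨g, g1, g2, g3, -⟩ := exists_conj_pair_normal _ (h * y * h⁻¹) k1 k2
    refine ⟨g * h, ?_⟩
    have e : ∀ z : Sp1, g * h * z * (g * h)⁻¹ = g * (h * z * h⁻¹) * g⁻¹ := fun z => by group
    rw [e, e, g1]
    exact ⟨k1, k2, k3, g2, g3⟩
  obtain ⟨h, p1, p2, p3, p4, p5⟩ := normal a b
  obtain ⟨h', q1, q2, q3, q4, q5⟩ := normal a' b'
  have r1 : (h * a * h⁻¹).1.re = (h' * a' * h'⁻¹).1.re := by rw [re_conj, re_conj, h1]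
  have r2 : (h * b * h⁻¹).1.re = (h' * b' * h'⁻¹).1.re := by rw [re_conj, re_conj, h2]
  have r3 : ((h * a * h⁻¹) * (h * b * h⁻¹)).1.re = ((h' * a' * h'⁻¹) * (h' * b' * h'⁻¹)).1.re := by
    have e : ∀ g x y : Sp1, (g * x * g⁻¹) * (g * y * g⁻¹) = g * (x * y) * g⁻¹ :=
      fun g x y => by group
    rw [e, e, re_conj, re_conj, h3]
  have r0 : (h * a * h⁻¹).1.re ^ 2 ≠ 1 := by rwa [re_conj]
  have eA : h * a * h⁻¹ = h' * a' * h'⁻¹ ∧ h * b * h⁻¹ = h' * b' * h'⁻¹ := by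
    generalize h * a * h⁻¹ = A at *
    generalize h * b * h⁻¹ = B at *
    generalize h' * a' * h'⁻¹ = A' at *
    generalize h' * b' * h'⁻¹ = B' at *
    have sA := sum_sq_Sp1 A
    have sA' := sum_sq_Sp1 A'
    have sB := sum_sq_Sp1 B
    have sB' := sum_sq_Sp1 B'
    rw [p1, p2] at sA
    rw [q1, q2, ← r1] at sA'
    have i1 : A.1.imI = A'.1.imI :=
      (sq_eq_sq₀ p3 q3).mp (by linarith)
    have hA0 : A.1.imI ≠ 0 := fun h => r0 (by rw [h] at sA; linarith)
    have i2 : B.1.imI = B'.1.imI := by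
      simp only [coe_mul_Sp1, Quaternion.re_mul, p1, p2, q1, q2, ← r1, ← r2, ← i1] at r3
      exact mul_left_cancel₀ hA0 (by linarith)
    have i3 : B.1.imJ = B'.1.imJ := by
      rw [p4] at sB
      rw [q4, ← r2, ← i2] at sB'
      exact (sq_eq_sq₀ p5 q5).mp (by linarith)
    exact ⟨Sp1_ext r1 i1 (p1.trans q1.symm) (p2.trans q2.symm),
      Sp1_ext r2 i2 i3 (p4.trans q4.symm)⟩
  refine ⟨h'⁻¹ * h, ?_, ?_⟩
  · calc h'⁻¹ * h * a * (h'⁻¹ * h)⁻¹ = h'⁻¹ * (h * a * h⁻¹) * h' := by group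
      _ = a' := by rw [eA.1]; group
  · calc h'⁻¹ * h * b * (h'⁻¹ * h)⁻¹ = h'⁻¹ * (h * b * h⁻¹) * h' := by group
      _ = b' := by rw [eA.2]; group

/-! ### Finite subgroups of the circle -/

/-- A finite subgroup of the circle consists of all roots of unity of its order. -/
theorem mem_finite_circle_iff (K : Subgroup Circle) [Finite K] (z : Circle) :
    z ∈ K ↔ z ^ Nat.card K = 1 := by
  have : NeZero (Nat.card K) := ⟨Nat.card_pos.ne'⟩
  have hinj : Function.Injective Circle.toUnits := fun a b h => by
    ext; simpa using congrArg Units.val h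
  have hle : K.map Circle.toUnits ≤ rootsOfUnity (Nat.card K) ℂ := by
    rintro _ ⟨z, hz, rfl⟩
    rw [_root_.mem_rootsOfUnity, ← map_pow]
    have : (⟨z, hz⟩ : K) ^ Nat.card K = 1 := pow_card_eq_one'
    rw [show z ^ Nat.card K = 1 from congrArg Subtype.val this, map_one]
  have heq : K.map Circle.toUnits = rootsOfUnity (Nat.card K) ℂ := by
    apply Subgroup.eq_of_le_of_card_ge hle
    rw [Complex.card_rootsOfUnity, Subgroup.card_map_of_injective hinj]
  constructor
  · intro hz
    have := hle ⟨z, hz, rfl⟩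
    rw [_root_.mem_rootsOfUnity, ← map_pow] at this
    exact hinj (this.trans (map_one _).symm)
  · intro hz
    have : Circle.toUnits z ∈ K.map Circle.toUnits := by
      rw [heq, _root_.mem_rootsOfUnity, ← map_pow, hz, map_one]
    obtain ⟨w, hw, e⟩ := this
    exact hinj e ▸ hw

/-- The circle `{expI θ}` as a homomorphism into `Sp(1)`. -/
noncomputable def circleHom : Circle →* Sp1 where
  toFun z := unitQuat (z : ℂ).re (z : ℂ).im 0 0 (by
    have := Circle.normSq_coe z
    rw [Complex.normSq_apply] at this
    linarith)
  map_one' := by apply Sp1_ext <;> simp [coe_unitQuat]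
  map_mul' z w := by apply Sp1_ext <;> simp [coe_unitQuat]

theorem circleHom_exp (t : ℝ) : circleHom (Circle.exp t) = expI t := by
  apply Sp1_ext <;>
    simp [circleHom, expI, coe_unitQuat, Circle.coe_exp, Complex.exp_ofReal_mul_I_re,
      Complex.exp_ofReal_mul_I_im]

theorem circleHom_injective : Function.Injective circleHom := fun z w h => by
  have h0 := congrArg (fun x : Sp1 => x.1.re) h
  have h1 := congrArg (fun x : Sp1 => x.1.imI) h
  exact Circle.ext (Complex.ext h0 h1)

theorem exists_circleHom_eq {x : Sp1} (hJ : x.1.imJ = 0) (hK : x.1.imK = 0) :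
    ∃ z, circleHom z = x := by
  have hs := sum_sq_Sp1 x
  rw [hJ, hK] at hs
  refine ⟨⟨⟨x.1.re, x.1.imI⟩, mem_sphere_zero_iff_norm.mpr ?_⟩, ?_⟩
  · rw [← sq_eq_sq₀ (norm_nonneg _) zero_le_one, Complex.sq_norm, Complex.normSq_apply]
    linarith
  · apply Sp1_ext <;> simp [circleHom, coe_unitQuat, hJ, hK]

/-- The elements of a finite group `G` of unit quaternions on the standard circle are the powers
of `exp (2πi / m)`, for some `m`. -/
theorem exists_circle_generator (G : Subgroup Sp1) [Finite G] :
    ∃ m : ℕ, 0 < m ∧ expI (2 * Real.pi / m) ∈ G ∧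
      (∀ x ∈ G, x.1.imJ = 0 → x.1.imK = 0 → ∃ k : ℕ, x = expI (2 * Real.pi / m) ^ k) ∧
      (-1 ∈ G → Even m) := by
  let K := G.comap circleHom
  have : Finite K := by
    refine Finite.of_injective (fun z : K => (⟨circleHom z.1, z.2⟩ : G)) fun z w h => ?_
    exact Subtype.ext (circleHom_injective (congrArg Subtype.val h))
  have hm : 0 < Nat.card K := Nat.card_pos
  have hm' : (Nat.card K : ℝ) ≠ 0 := by exact_mod_cast hm.ne'
  refine ⟨Nat.card K, hm, ?_, ?_, ?_⟩
  · rw [← circleHom_exp]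
    change Circle.exp (2 * Real.pi / Nat.card K) ∈ K
    rw [mem_finite_circle_iff, ← Circle.exp_nsmul, nsmul_eq_mul, mul_div_cancel₀ _ hm',
      Circle.exp_two_pi]
  · intro x hx hJ hK
    obtain ⟨z, rfl⟩ := exists_circleHom_eq hJ hK
    have hz : z ^ Nat.card K = 1 := (mem_finite_circle_iff K z).mp hx
    have hz' : (z : ℂ) ^ Nat.card K = 1 := by
      have := congrArg (fun w : Circle => (w : ℂ)) hz
      simpa using this
    obtain ⟨k, -, hk⟩ := (Complex.isPrimitiveRoot_exp _ hm.ne').eq_pow_of_pow_eq_one hz'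
    refine ⟨k, ?_⟩
    rw [← circleHom_exp, ← map_pow]
    congr 1
    ext
    rw [← hk, Circle.coe_pow, Circle.coe_exp]
    congr 2
    push_cast
    ring
  · intro h
    have h1 : (-1 : Sp1) = circleHom (Circle.exp Real.pi) := by rw [circleHom_exp, expI_pi]
    have h2 : Circle.exp Real.pi ∈ K := by
      change circleHom _ ∈ G
      rwa [← h1]
    have h3 := (mem_finite_circle_iff K _).mp h2
    have h4 : ((-1 : ℂ)) ^ Nat.card K = 1 := by
      have := congrArg (fun w : Circle => (w : ℂ)) h3
      simpa [Circle.coe_exp] using this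
    exact (neg_one_pow_eq_one_iff_even (by norm_num)).mp h4

/-- A finite group of unit quaternions inside the standard circle is cyclic, generated by
`exp (2πi / m)`. -/
theorem eq_closure_of_le_circle (G : Subgroup Sp1) [Finite G]
    (hG : ∀ x ∈ G, x.1.imJ = 0 ∧ x.1.imK = 0) (hne : G ≠ ⊥) : IsADE G := by
  obtain ⟨m, hm, hmem, hpow, -⟩ := exists_circle_generator G
  have e : G = Subgroup.closure {expI (2 * Real.pi / m)} := by
    apply le_antisymm
    · intro x hx
      obtain ⟨k, rfl⟩ := hpow x hx (hG x hx).1 (hG x hx).2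
      exact pow_mem (Subgroup.subset_closure (Set.mem_singleton _)) k
    · rw [Subgroup.closure_le, Set.singleton_subset_iff]
      exact hmem
  have h2 : 2 ≤ m := by
    by_contra hlt
    have h1 : m = 1 := by omega
    apply hne
    rw [e, h1, eq_bot_iff, Subgroup.closure_le, Set.singleton_subset_iff, SetLike.mem_coe,
      Subgroup.mem_bot]
    have : expI (2 * Real.pi / (1 : ℕ)) = expI Real.pi * expI Real.pi := by
      rw [← expI_add]; congr 1; push_cast; ring
    rw [this, expI_pi]; simp
  rw [e]
  exact IsADE.A m h2

/-- The largest `cos (kπ / m)` below `1` is `cos (π / m)`. -/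
theorem cos_mul_pi_div_le {m : ℕ} (hm : 0 < m) (k : ℕ) :
    Real.cos (k * (Real.pi / m)) = 1 ∨ Real.cos (k * (Real.pi / m)) ≤ Real.cos (Real.pi / m) := by
  have hm' : (0 : ℝ) < m := by exact_mod_cast hm
  have hpi := Real.pi_pos
  have red : Real.cos (k * (Real.pi / m)) = Real.cos ((k % (2 * m) : ℕ) * (Real.pi / m)) := by
    have h : (k : ℝ) = ((k % (2 * m) : ℕ) : ℝ) + 2 * m * ((k / (2 * m) : ℕ) : ℝ) := by
      exact_mod_cast (Nat.mod_add_div k (2 * m)).symm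
    have e : (k : ℝ) * (Real.pi / m) = ((k % (2 * m) : ℕ) : ℝ) * (Real.pi / m) +
        ((k / (2 * m) : ℕ) : ℝ) * (2 * Real.pi) := by
      conv_lhs => rw [h]
      field_simp
    rw [e, Real.cos_add_nat_mul_two_pi]
  rw [red]
  have hlt : k % (2 * m) < 2 * m := Nat.mod_lt _ (by omega)
  generalize k % (2 * m) = l at hlt
  have hstep : 0 < Real.pi / m := by positivity
  have main : ∀ j : ℕ, 1 ≤ j → j ≤ m →
      Real.cos (j * (Real.pi / m)) ≤ Real.cos (Real.pi / m) := by
    intro j h1 h2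
    have h1' : (1 : ℝ) ≤ j := by exact_mod_cast h1
    have h2' : (j : ℝ) ≤ m := by exact_mod_cast h2
    apply Real.cos_le_cos_of_nonneg_of_le_pi hstep.le
    · calc (j : ℝ) * (Real.pi / m) ≤ m * (Real.pi / m) := by gcongr
        _ = Real.pi := by field_simp
    · nlinarith
  rcases Nat.eq_zero_or_pos l with rfl | hl
  · left; simp
  · right
    rcases le_or_gt l m with h | h
    · exact main l hl h
    · have := main (2 * m - l) (by omega) (by omega)
      rw [Nat.cast_sub hlt.le] at this
      rwa [show (((2 * m : ℕ) : ℝ) - l) * (Real.pi / m) = 2 * Real.pi - l * (Real.pi / m) by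
        push_cast; field_simp, Real.cos_two_pi_sub] at this

theorem mem_conj_smul {G : Subgroup Sp1} {h x : Sp1} :
    x ∈ MulAut.conj h • G ↔ h⁻¹ * x * h ∈ G := by
  rw [Subgroup.mem_pointwise_smul_iff_inv_smul_mem, ← map_inv]
  simp [MulAut.smul_def]

instance finite_conj_smul (G : Subgroup Sp1) [Finite G] (h : Sp1) :
    Finite (MulAut.conj h • G : Subgroup Sp1) :=
  Finite.of_injective (fun x => (⟨h⁻¹ * x.1 * h, mem_conj_smul.mp x.2⟩ : G)) fun x y e => by
    have := congrArg Subtype.val e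
    exact Subtype.ext (by simpa using this)

/-- In a finite group containing `-1`, every element has real part `cos (kπ / m)`, where
`cos (π / m)` is the real part of some other element. -/
theorem exists_re_eq_cos (G : Subgroup Sp1) [Finite G] (hneg : -1 ∈ G) {x : Sp1} (hx : x ∈ G) :
    ∃ m : ℕ, 0 < m ∧ (∃ h ∈ G, h.1.re = Real.cos (Real.pi / m)) ∧
      ∃ k : ℕ, x.1.re = Real.cos (k * (Real.pi / m)) := by
  obtain ⟨h, hJ, hK, -⟩ := exists_conj_circle x
  obtain ⟨m, hm, hmem, hpow, heven⟩ := exists_circle_generator (MulAut.conj h • G)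
  have hneg' : -1 ∈ MulAut.conj h • G := by
    rw [mem_conj_smul]; simpa using hneg
  obtain ⟨m, rfl⟩ := (heven hneg').two_dvd
  have e : 2 * Real.pi / ((2 * m : ℕ) : ℝ) = Real.pi / m := by
    push_cast; rw [mul_div_mul_left _ _ two_ne_zero]
  rw [e] at hmem hpow
  refine ⟨m, by omega, ⟨_, mem_conj_smul.mp hmem, ?_⟩, ?_⟩
  · have := re_conj h⁻¹ (expI (Real.pi / m))
    rw [inv_inv] at this
    rw [this]; rfl
  · obtain ⟨k, hk⟩ := hpow (h * x * h⁻¹) (mem_conj_smul.mpr (by simpa [mul_assoc] using hx)) hJ hK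
    refine ⟨k, ?_⟩
    rw [← re_conj h, hk, ← expI_nat_mul]; rfl

/-- The real parts in a finite group containing `-1`: the largest one below `1` is `cos (π / n)`
for some `n`, and all are of the form `cos (kπ / m)` with `m ≤ n`. -/
theorem exists_max_re (G : Subgroup Sp1) [Finite G] (hneg : -1 ∈ G) :
    ∃ n : ℕ, 0 < n ∧ (∃ a ∈ G, a.1.re = Real.cos (Real.pi / n)) ∧
      (∀ x ∈ G, x ≠ 1 → x.1.re ≤ Real.cos (Real.pi / n)) ∧
      ∀ x ∈ G, ∃ m : ℕ, 0 < m ∧ m ≤ n ∧ ∃ k : ℕ, x.1.re = Real.cos (k * (Real.pi / m)) := by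
  have hne1 : (-1 : Sp1) ≠ 1 := fun h => by
    have := congrArg (fun x : Sp1 => x.1.re) h
    norm_num [coe_neg_Sp1] at this
  have : Nonempty {x : G // x.1 ≠ 1} := ⟨⟨⟨-1, hneg⟩, hne1⟩⟩
  obtain ⟨⟨⟨a, ha⟩, ha1⟩, hmax⟩ := Finite.exists_max (fun x : {x : G // x.1 ≠ 1} => x.1.1.1.re)
  have hmax' : ∀ x ∈ G, x ≠ 1 → x.1.re ≤ a.1.re := fun x hx h1 => hmax ⟨⟨x, hx⟩, h1⟩
  have cos_lt : ∀ m : ℕ, 0 < m → Real.cos (Real.pi / m) < 1 := by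
    intro m hm
    have hm' : (1 : ℝ) ≤ m := by exact_mod_cast hm
    rw [← Real.cos_zero]
    apply Real.cos_lt_cos_of_nonneg_of_le_pi le_rfl
    · exact div_le_self Real.pi_pos.le hm'
    · have := Real.pi_pos; positivity
  obtain ⟨n, hn, ⟨h, hh, hre⟩, k, hk⟩ := exists_re_eq_cos G hneg ha
  have hne : ∀ {m : ℕ} {x : Sp1}, 0 < m → x.1.re = Real.cos (Real.pi / m) → x ≠ 1 := by
    rintro m x hm hx rfl
    have := cos_lt m hm
    rw [← hx] at this
    norm_num at this
  have hM : a.1.re = Real.cos (Real.pi / n) := by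
    apply le_antisymm
    · rcases cos_mul_pi_div_le hn k with h1 | h1
      · exact absurd (eq_one_of_re_eq_one (hk.trans h1)) ha1
      · rw [hk]; exact h1
    · rw [← hre]; exact hmax' h hh (hne hn hre)
  refine ⟨n, hn, ⟨a, ha, hM⟩, fun x hx h1 => hM ▸ hmax' x hx h1, fun x hx => ?_⟩
  obtain ⟨m, hm, ⟨y, hy, hyre⟩, k, hk⟩ := exists_re_eq_cos G hneg hx
  refine ⟨m, hm, ?_, k, hk⟩
  by_contra hlt
  have hlt' : (n : ℝ) < m := by exact_mod_cast not_le.mp hlt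
  have hn' : (1 : ℝ) ≤ n := by exact_mod_cast hn
  have hle := hmax' y hy (hne hm hyre)
  rw [hyre, hM] at hle
  refine absurd hle (not_le.mpr ?_)
  have hpi := Real.pi_pos
  apply Real.cos_lt_cos_of_nonneg_of_le_pi (by positivity)
  · exact div_le_self hpi.le hn'
  · gcongr

/-! ### Cosets and elements of maximal real part -/

theorem exists_maximal_coset {G E : Subgroup Sp1} [Finite G] (hE : E ≤ G) (x : Sp1) :
    ∃ e ∈ E, ∀ e' ∈ E, (e' * (e * x)).1.re ≤ (e * x).1.re := by
  have : Finite E := Finite.of_injective _ (Subgroup.inclusion_injective hE)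
  obtain ⟨⟨e, he⟩, hmax⟩ := Finite.exists_max (fun e : E => (e.1 * x).1.re)
  refine ⟨e, he, fun e' he' => ?_⟩
  rw [← mul_assoc]
  exact hmax ⟨e' * e, mul_mem he' he⟩

/-- A subgroup `E` of a finite group `G` is all of `G` if the only element of `G` that has maximal
real part in its coset of `E` is `1`. -/
theorem le_of_maximal_eq_one {G E : Subgroup Sp1} [Finite G] (hE : E ≤ G)
    (H : ∀ y ∈ G, (∀ e ∈ E, (e * y).1.re ≤ y.1.re) → y = 1) : G ≤ E := by
  intro x hx
  obtain ⟨e, he, hmax⟩ := exists_maximal_coset hE x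
  rw [← inv_eq_of_mul_eq_one_right (H _ (mul_mem (hE he) hx) hmax)]
  exact inv_mem he

/-- `|w|²` for the unit quaternion `z + w j`: how far it is from the standard circle. -/
noncomputable def offCircle (x : Sp1) : ℝ := x.1.imJ ^ 2 + x.1.imK ^ 2

theorem sum_sq_eq_one_sub_offCircle (x : Sp1) :
    x.1.re ^ 2 + x.1.imI ^ 2 = 1 - offCircle x := by
  have := sum_sq_Sp1 x
  rw [offCircle]; linarith

theorem offCircle_nonneg (x : Sp1) : 0 ≤ offCircle x := by rw [offCircle]; positivity

theorem offCircle_eq_zero {x : Sp1} (h : offCircle x = 0) : x.1.imJ = 0 ∧ x.1.imK = 0 := by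
  rw [offCircle] at h
  constructor <;> apply pow_eq_zero_iff (two_ne_zero) |>.mp <;>
    nlinarith [sq_nonneg x.1.imJ, sq_nonneg x.1.imK]

theorem eq_zero_of_offCircle_eq_one {x : Sp1} (h : offCircle x = 1) :
    x.1.re = 0 ∧ x.1.imI = 0 := by
  have := sum_sq_eq_one_sub_offCircle x
  constructor <;> apply pow_eq_zero_iff (two_ne_zero) |>.mp <;>
    nlinarith [sq_nonneg x.1.re, sq_nonneg x.1.imI]

theorem re_expI_mul (t : ℝ) (x : Sp1) :
    (expI t * x).1.re = Real.cos t * x.1.re - Real.sin t * x.1.imI := by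
  simp [Quaternion.re_mul, expI, coe_unitQuat]

theorem re_expI_mul_expI_mul (t : ℝ) (x : Sp1) :
    (expI t * (expI t * x)).1.re = 2 * Real.cos t * (expI t * x).1.re - x.1.re := by
  rw [← mul_assoc, ← expI_add, ← two_mul, re_expI_mul, re_expI_mul, Real.cos_two_mul,
    Real.sin_two_mul]
  ring

theorem offCircle_expI_mul (t : ℝ) (x : Sp1) : offCircle (expI t * x) = offCircle x := by
  have h := Real.cos_sq_add_sin_sq t
  simp only [offCircle, coe_mul_Sp1, Quaternion.imJ_mul, Quaternion.imK_mul, expI, coe_unitQuat,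
    quat_re, quat_imI, quat_imJ, quat_imK]
  linear_combination (x.1.imJ ^ 2 + x.1.imK ^ 2) * h

theorem offCircle_mul_of_mem_zpowers (t : ℝ) {e : Sp1} (he : e ∈ Subgroup.zpowers (expI t))
    (x : Sp1) : offCircle (e * x) = offCircle x := by
  obtain ⟨k, rfl⟩ := he
  have : ∃ s, expI t ^ k = expI s := by
    rcases Int.eq_nat_or_neg k with ⟨n, rfl | rfl⟩
    · exact ⟨n * t, by rw [expI_nat_mul, zpow_natCast]⟩
    · exact ⟨-(n * t), by rw [← expI_inv, expI_nat_mul, zpow_neg, zpow_natCast]⟩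
  obtain ⟨s, hs⟩ := this
  change offCircle (expI t ^ k * x) = _
  rw [hs, offCircle_expI_mul]

/-- The real part of a commutator measures how far `x` is from normalising the circle. -/
theorem re_commutator_expI (t : ℝ) (x : Sp1) :
    (expI t * x * (expI t)⁻¹ * x⁻¹).1.re = 1 - 2 * Real.sin t ^ 2 * offCircle x := by
  have h := Real.cos_sq_add_sin_sq t
  have hs := sum_sq_Sp1 x
  simp only [offCircle, coe_mul_Sp1, coe_inv_Sp1, Quaternion.imJ_mul, Quaternion.imK_mul,
    Quaternion.imI_mul, Quaternion.re_mul, Quaternion.re_star, Quaternion.imI_star,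
    Quaternion.imJ_star, Quaternion.imK_star, expI, coe_unitQuat,
    quat_re, quat_imI, quat_imJ, quat_imK]
  linear_combination (x.1.re ^ 2 + x.1.imI ^ 2 + x.1.imJ ^ 2 + x.1.imK ^ 2) * h + hs

/-- The effect on `offCircle` of passing from `x` to the conjugate of `exp (it)` by `x`: iterating
this step yields the constraints on `n`. -/
theorem offCircle_conj_expI (t : ℝ) (x : Sp1) :
    offCircle (x * expI t * x⁻¹) =
      4 * Real.sin t ^ 2 * offCircle x * (1 - offCircle x) := by
  have hs := sum_sq_eq_one_sub_offCircle x
  rw [← hs]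
  simp only [offCircle, coe_mul_Sp1, coe_inv_Sp1, Quaternion.imJ_mul, Quaternion.imK_mul,
    Quaternion.imI_mul, Quaternion.re_mul, Quaternion.re_star, Quaternion.imI_star,
    Quaternion.imJ_star, Quaternion.imK_star, expI, coe_unitQuat,
    quat_re, quat_imI, quat_imJ, quat_imK]
  ring

/-- Conjugation by elements that commute with `exp (it)` preserves `offCircle`, because it preserves
the real part of the commutator with `exp (it)`. -/
theorem offCircle_conj {t : ℝ} (ht : Real.sin t ≠ 0) {h : Sp1} (hh : h * expI t * h⁻¹ = expI t)
    (x : Sp1) : offCircle (h * x * h⁻¹) = offCircle x := by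
  have e : expI t * (h * x * h⁻¹) * (expI t)⁻¹ * (h * x * h⁻¹)⁻¹ =
      h * (expI t * x * (expI t)⁻¹ * x⁻¹) * h⁻¹ := by
    conv_lhs => rw [← hh]
    group
  have h1 := re_commutator_expI t (h * x * h⁻¹)
  rw [e, re_conj, re_commutator_expI] at h1
  have h2 : Real.sin t ^ 2 ≠ 0 := pow_ne_zero _ ht
  exact mul_left_cancel₀ h2 (by linarith)

/-- An element of maximal real part in its coset of `⟨exp (it)⟩` makes a small angle with `1`. -/
theorem le_re_sq_of_maximal {t : ℝ} (ht : Real.cos t < 1) {y : Sp1}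
    (hy : ∀ e ∈ Subgroup.zpowers (expI t), (e * y).1.re ≤ y.1.re) :
    0 ≤ y.1.re ∧ (1 - offCircle y) * (1 + Real.cos t) ≤ 2 * y.1.re ^ 2 := by
  have h1 := hy _ (Subgroup.mem_zpowers _)
  have h2 := hy _ (inv_mem (Subgroup.mem_zpowers _))
  rw [expI_inv] at h2
  rw [re_expI_mul] at h1 h2
  rw [Real.cos_neg, Real.sin_neg] at h2
  have hcs := Real.cos_sq_add_sin_sq t
  rw [← sum_sq_eq_one_sub_offCircle]
  have h0 : 0 ≤ y.1.re := by
    by_contra hneg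
    nlinarith [mul_pos (sub_pos.mpr ht) (neg_pos.mpr (not_le.mp hneg))]
  refine ⟨h0, ?_⟩
  have h3 : (Real.sin t * y.1.imI) ^ 2 ≤ ((1 - Real.cos t) * y.1.re) ^ 2 :=
    sq_le_sq' (by linarith) (by linarith)
  have h4 : (1 - Real.cos t) * ((1 + Real.cos t) * y.1.imI ^ 2) ≤
      (1 - Real.cos t) * ((1 - Real.cos t) * y.1.re ^ 2) := by
    have : Real.sin t ^ 2 = (1 - Real.cos t) * (1 + Real.cos t) := by linarith
    rw [mul_pow, this] at h3
    linarith
  have h5 := le_of_mul_le_mul_left h4 (sub_pos.mpr ht)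
  linarith

/-! ### Groups in normal position -/

/-- A finite group of unit quaternions in normal position: it contains `-1`, and
`exp (iπ / n)` is an element with the largest real part below `1`. -/
structure IsNormalPosition (n : ℕ) (G : Subgroup Sp1) : Prop where
  neg_one_mem : -1 ∈ G
  two_le : 2 ≤ n
  expI_mem : expI (Real.pi / n) ∈ G
  re_le : ∀ x ∈ G, x ≠ 1 → x.1.re ≤ Real.cos (Real.pi / n)
  re_eq : ∀ x ∈ G, ∃ m : ℕ, 0 < m ∧ m ≤ n ∧ ∃ k : ℕ, x.1.re = Real.cos (k * (Real.pi / m))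

namespace IsNormalPosition

variable {n : ℕ} {G : Subgroup Sp1}

theorem cos_nonneg (hG : IsNormalPosition n G) : 0 ≤ Real.cos (Real.pi / n) := by
  have h2 : (2 : ℝ) ≤ n := by exact_mod_cast hG.two_le
  have := Real.pi_pos
  apply Real.cos_nonneg_of_neg_pi_div_two_le_of_le
  · have : 0 ≤ Real.pi / n := by positivity
    linarith
  · gcongr

theorem sin_pos (hG : IsNormalPosition n G) : 0 < Real.sin (Real.pi / n) := by
  have h2 : (2 : ℝ) ≤ n := by exact_mod_cast hG.two_le
  have := Real.pi_pos
  apply Real.sin_pos_of_pos_of_lt_pi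
  · positivity
  · exact div_lt_self this (by linarith)

theorem cos_lt_one (hG : IsNormalPosition n G) : Real.cos (Real.pi / n) < 1 := by
  nlinarith [Real.cos_sq_add_sin_sq (Real.pi / n), hG.sin_pos, hG.cos_nonneg]

theorem eq_one_of_lt (hG : IsNormalPosition n G) {x : Sp1} (hx : x ∈ G)
    (h : Real.cos (Real.pi / n) ^ 2 < x.1.re ^ 2) (h0 : 0 ≤ x.1.re) : x = 1 := by
  by_contra hne
  exact absurd (hG.re_le x hx hne) (not_le.mpr ((sq_lt_sq₀ hG.cos_nonneg h0).mp h))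

theorem conj (hG : IsNormalPosition n G) {h : Sp1}
    (hh : h * expI (Real.pi / n) * h⁻¹ = expI (Real.pi / n)) :
    IsNormalPosition n (MulAut.conj h • G) where
  neg_one_mem := by rw [mem_conj_smul]; simpa using hG.neg_one_mem
  two_le := hG.two_le
  expI_mem := by
    rw [mem_conj_smul]
    have : h⁻¹ * expI (Real.pi / n) * h = expI (Real.pi / n) := by
      conv_lhs => rw [← hh]
      group
    rw [this]; exact hG.expI_mem
  re_le x hx h1 := by
    have := hG.re_le _ (mem_conj_smul.mp hx) (fun e => h1 (by
      rw [mul_assoc, inv_mul_eq_one] at e; simpa using e.symm))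
    rw [← re_conj h⁻¹, inv_inv]; exact this
  re_eq x hx := by
    have := hG.re_eq _ (mem_conj_smul.mp hx)
    rw [← re_conj h⁻¹ x, inv_inv]; exact this

/-- The elements on the standard circle are the powers of `exp (iπ / n)`: in its coset, an element
of maximal real part is closer to `1` than `exp (iπ / n)`. -/
theorem mem_zpowers_of_offCircle_eq_zero (hG : IsNormalPosition n G) [Finite G] {x : Sp1}
    (hx : x ∈ G) (h0 : offCircle x = 0) : x ∈ Subgroup.zpowers (expI (Real.pi / n)) := by
  have hE : Subgroup.zpowers (expI (Real.pi / n)) ≤ G := by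
    rw [Subgroup.zpowers_le]; exact hG.expI_mem
  obtain ⟨e, he, hmax⟩ := exists_maximal_coset hE x
  obtain ⟨h1, h2⟩ := le_re_sq_of_maximal hG.cos_lt_one hmax
  rw [offCircle_mul_of_mem_zpowers _ he, h0] at h2
  have h3 : e * x = 1 := by
    refine hG.eq_one_of_lt (mul_mem (hE he) hx) ?_ h1
    nlinarith [hG.cos_lt_one, hG.cos_nonneg]
  rw [← inv_eq_of_mul_eq_one_right h3]
  exact inv_mem he

/-- If all elements lie on the standard circle or its orthogonal circle, the group is cyclic or
conjugate to a binary dihedral group. -/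
theorem cyclic_or_dihedral (hG : IsNormalPosition n G) [Finite G]
    (H : ∀ x ∈ G, offCircle x = 0 ∨ offCircle x = 1) :
    (∀ x ∈ G, x.1.imJ = 0 ∧ x.1.imK = 0) ∨
      ∃ h : Sp1, MulAut.conj h • G = Subgroup.closure {quatJ, expI (Real.pi / n)} := by
  by_cases hx : ∃ x ∈ G, offCircle x = 1
  · right
    obtain ⟨x, hx, hx1⟩ := hx
    obtain ⟨x0, x1⟩ := eq_zero_of_offCircle_eq_one hx1
    obtain ⟨h, hh, k1, k2, k3⟩ := exists_conj_pair_normal (expI (Real.pi / n)) x rfl rfl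
    have hj : h * x * h⁻¹ = quatJ := by
      have hs := sum_sq_Sp1 (h * x * h⁻¹)
      have hr : (h * x * h⁻¹).1.re = 0 := by rw [re_conj, x0]
      rw [x1] at k3
      rw [hr, k1, k3] at hs
      refine Sp1_ext hr k3 ?_ k1
      change _ = (1 : ℝ)
      nlinarith
    have hG' := hG.conj hh
    have hjG : quatJ ∈ MulAut.conj h • G := by
      rw [mem_conj_smul, ← hj]; simpa [mul_assoc] using hx
    refine ⟨h, le_antisymm ?_ ?_⟩
    · have hz : Subgroup.zpowers (expI (Real.pi / n)) ≤
          Subgroup.closure {quatJ, expI (Real.pi / n)} := by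
        rw [Subgroup.zpowers_le]
        exact Subgroup.subset_closure (Set.mem_insert_of_mem _ (Set.mem_singleton _))
      intro y hy
      have hy' : offCircle y = 0 ∨ offCircle y = 1 := by
        have := offCircle_conj hG.sin_pos.ne' hh (h⁻¹ * y * h)
        rw [show h * (h⁻¹ * y * h) * h⁻¹ = y by group] at this
        rw [this]
        exact H _ (mem_conj_smul.mp hy)
      rcases hy' with h0 | h1
      · exact hz (hG'.mem_zpowers_of_offCircle_eq_zero hy h0)
      · have h2 : offCircle (y * quatJ⁻¹) = 0 := by
          obtain ⟨y0, y1⟩ := eq_zero_of_offCircle_eq_one h1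
          simp [offCircle, coe_inv_Sp1, Quaternion.imJ_mul, Quaternion.imK_mul, quatJ,
            coe_unitQuat, y0, y1]
        have h3 := hz (hG'.mem_zpowers_of_offCircle_eq_zero (mul_mem hy (inv_mem hjG)) h2)
        have h4 := mul_mem h3 (Subgroup.subset_closure (Set.mem_insert quatJ _))
        rwa [inv_mul_cancel_right] at h4
    · rw [Subgroup.closure_le, Set.insert_subset_iff, Set.singleton_subset_iff]
      exact ⟨hjG, hG'.expI_mem⟩
  · left
    intro x hxG
    rcases H x hxG with h | h
    · exact offCircle_eq_zero h
    · exact absurd ⟨x, hxG, h⟩ hx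

/-- Jørgensen-type inequality: the commutator of `exp (iπ / n)` and `x` has real part at most
`cos (π / n)`, unless it is `1`. -/
theorem one_le_mul_offCircle (hG : IsNormalPosition n G) {x : Sp1} (hx : x ∈ G)
    (h0 : offCircle x ≠ 0) :
    1 ≤ 2 * (1 + Real.cos (Real.pi / n)) * offCircle x := by
  have h1 := re_commutator_expI (Real.pi / n) x
  have h2 := hG.re_le _ (mul_mem (mul_mem (mul_mem hG.expI_mem hx) (inv_mem hG.expI_mem))
    (inv_mem hx)) (fun e => by
      rw [e] at h1
      have : 2 * Real.sin (Real.pi / n) ^ 2 * offCircle x = 0 := by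
        rw [Submonoid.coe_one, Quaternion.re_one] at h1; linarith
      have hs := pow_ne_zero 2 hG.sin_pos.ne'
      simp_all)
  rw [h1] at h2
  have h3 := Real.cos_sq_add_sin_sq (Real.pi / n)
  have h4 : (1 - Real.cos (Real.pi / n)) * 1 ≤ (1 - Real.cos (Real.pi / n)) *
      (2 * (1 + Real.cos (Real.pi / n)) * offCircle x) := by
    have : Real.sin (Real.pi / n) ^ 2 =
      (1 - Real.cos (Real.pi / n)) * (1 + Real.cos (Real.pi / n)) := by linarith
    rw [this] at h2
    linarith
  exact le_of_mul_le_mul_left h4 (sub_pos.mpr hG.cos_lt_one)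

/-- For `n ≥ 6` all elements normalise the standard circle, since `x` and the conjugate of
`exp (iπ / n)` by `x` cannot both satisfy the Jørgensen-type inequality. -/
theorem offCircle_of_six_le (hG : IsNormalPosition n G) (hn : 6 ≤ n) {x : Sp1} (hx : x ∈ G) :
    offCircle x = 0 ∨ offCircle x = 1 := by
  by_contra hcon
  push Not at hcon
  obtain ⟨h0, h1⟩ := hcon
  have hb : x * expI (Real.pi / n) * x⁻¹ ∈ G := mul_mem (mul_mem hx hG.expI_mem) (inv_mem hx)
  have e := offCircle_conj_expI (Real.pi / n) x
  have hs := hG.sin_pos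
  have hne : offCircle (x * expI (Real.pi / n) * x⁻¹) ≠ 0 := by
    rw [e]
    have : 1 - offCircle x ≠ 0 := fun h => h1 (by linarith)
    positivity
  have key := hG.one_le_mul_offCircle hb hne
  rw [e] at key
  have hcs := Real.cos_sq_add_sin_sq (Real.pi / n)
  have hc : √3 / 2 ≤ Real.cos (Real.pi / n) := by
    rw [← Real.cos_pi_div_six]
    have := Real.pi_pos
    have h6 : (6 : ℝ) ≤ n := by exact_mod_cast hn
    apply Real.cos_le_cos_of_nonneg_of_le_pi (by positivity) (by linarith)
    gcongr
  have h3 : (1.73 : ℝ) ≤ √3 := Real.le_sqrt_of_sq_le (by norm_num)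
  have hc1 := hG.cos_lt_one
  generalize Real.cos (Real.pi / n) = c at *
  generalize offCircle x = u at *
  have hu : 4 * (u * (1 - u)) ≤ 1 := by nlinarith [sq_nonneg (2 * u - 1)]
  have hc2 : (0.865 : ℝ) ≤ c := by linarith
  have hs2 : Real.sin (Real.pi / n) ^ 2 ≤ 0.26 := by nlinarith
  have h5 : Real.sin (Real.pi / n) ^ 2 * (4 * (u * (1 - u))) ≤ Real.sin (Real.pi / n) ^ 2 :=
    mul_le_of_le_one_right (by positivity) hu
  -- the right-hand side of `key` is at most `2 (1 + c) (1 - c²)`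
  have h6 : 2 * (1 + c) * (4 * Real.sin (Real.pi / n) ^ 2 * u * (1 - u)) ≤
      2 * (1 + c) * (1 - c ^ 2) := by
    apply mul_le_mul_of_nonneg_left _ (by linarith)
    linarith
  nlinarith

end IsNormalPosition

/-! ### Real parts in groups with small `n` -/

/-- The squares of the numbers `cos (kπ / m)`, `m ≤ 5`: they are found from the Chebyshev
polynomials, since `T_m (cos (kπ / m)) = ±1`. -/
theorem cos_sq_cases {m : ℕ} (hm : 0 < m) (k : ℕ) {x : ℝ} (hx : x = Real.cos (k * (Real.pi / m))) :
    x ^ 2 = 1 ∨ (m = 2 ∧ x ^ 2 = 0) ∨ (m = 3 ∧ x ^ 2 = 1 / 4) ∨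
      (m = 4 ∧ (x ^ 2 = 0 ∨ x ^ 2 = 1 / 2)) ∨ (m = 5 ∧ 16 * x ^ 4 - 12 * x ^ 2 + 1 = 0) ∨
      6 ≤ m := by
  have hm' : (m : ℝ) ≠ 0 := by exact_mod_cast hm.ne'
  have h1 : Real.cos (m * (k * (Real.pi / m))) ^ 2 = 1 := by
    rw [show (m : ℝ) * (k * (Real.pi / m)) = k * Real.pi by field_simp, Real.cos_nat_mul_pi,
      ← pow_mul, mul_comm, pow_mul]
    norm_num
  generalize (k : ℝ) * (Real.pi / m) = t at h1 hx
  rcases le_or_gt 6 m with h6 | h6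
  · simp [h6]
  have c2 := Real.cos_two_mul t
  have c3 := Real.cos_three_mul t
  have c4 := Real.cos_two_mul (2 * t)
  have c5 : Real.cos (5 * t) = 16 * Real.cos t ^ 5 - 20 * Real.cos t ^ 3 + 5 * Real.cos t := by
    have := Real.cos_add_cos (5 * t) t
    rw [show (5 * t + t) / 2 = 3 * t by ring, show (5 * t - t) / 2 = 2 * t by ring, c2, c3] at this
    linear_combination this
  rw [← mul_assoc, c2] at c4
  rw [← hx] at c2 c3 c4 c5
  obtain rfl | rfl | rfl | rfl | rfl : m = 1 ∨ m = 2 ∨ m = 3 ∨ m = 4 ∨ m = 5 := by omega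
  · left
    rwa [Nat.cast_one, one_mul, ← hx] at h1
  · rw [Nat.cast_ofNat, c2] at h1
    have : (x ^ 2 - 1) * x ^ 2 = 0 := by linear_combination h1 / 4
    rcases mul_eq_zero.mp this with h | h
    · left; linarith
    · right; left; exact ⟨rfl, h⟩
  · rw [Nat.cast_ofNat, c3] at h1
    have : (x ^ 2 - 1) * (4 * x ^ 2 - 1) ^ 2 = 0 := by linear_combination h1
    rcases mul_eq_zero.mp this with h | h
    · left; linarith
    · right; right; left
      exact ⟨rfl, by linarith [pow_eq_zero_iff (two_ne_zero) |>.mp h]⟩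
  · rw [Nat.cast_ofNat, show (4 : ℝ) = 2 * 2 by norm_num, c4] at h1
    have : (x ^ 2 - 1) * (x ^ 2 * (2 * x ^ 2 - 1) ^ 2) = 0 := by linear_combination h1 / 16
    rcases mul_eq_zero.mp this with h | h
    · left; linarith
    · right; right; right; left
      refine ⟨rfl, ?_⟩
      rcases mul_eq_zero.mp h with h | h
      · left; exact h
      · right; linarith [pow_eq_zero_iff (two_ne_zero) |>.mp h]
  · rw [Nat.cast_ofNat, c5] at h1
    have : (x ^ 2 - 1) * (16 * x ^ 4 - 12 * x ^ 2 + 1) ^ 2 = 0 := by linear_combination h1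
    rcases mul_eq_zero.mp this with h | h
    · left; linarith
    · right; right; right; right; left
      exact ⟨rfl, pow_eq_zero_iff (two_ne_zero) |>.mp h⟩

theorem goldenRatio_bounds : (1.618 : ℝ) ≤ Real.goldenRatio ∧ Real.goldenRatio ≤ 1.6185 := by
  rw [Real.goldenRatio]
  have h1 : (2.236 : ℝ) ≤ √5 := Real.le_sqrt_of_sq_le (by norm_num)
  have h2 : √5 ≤ 2.237 := Real.sqrt_le_iff.mpr (by norm_num)
  constructor <;> linarith

theorem cos_pi_div_five_cast : Real.cos (Real.pi / (5 : ℕ)) = Real.goldenRatio / 2 := by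
  rw [Nat.cast_ofNat, Real.cos_pi_div_five, Real.goldenRatio]; ring

theorem sin_sq_pi_div_five : Real.sin (Real.pi / (5 : ℕ)) ^ 2 = (3 - Real.goldenRatio) / 4 := by
  have := Real.cos_sq_add_sin_sq (Real.pi / (5 : ℕ))
  rw [cos_pi_div_five_cast] at this
  linear_combination this - Real.goldenRatio_sq / 4

namespace IsNormalPosition

variable {n : ℕ} {G : Subgroup Sp1}

theorem offCircle_of_two (hG : IsNormalPosition 2 G) {x : Sp1} (hx : x ∈ G) :
    offCircle x = 0 ∨ offCircle x = 1 := by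
  have val : ∀ y ∈ G, y.1.re ^ 2 = 1 ∨ y.1.re ^ 2 = 0 := by
    intro y hy
    obtain ⟨m, hm, hmn, k, hk⟩ := hG.re_eq y hy
    rcases cos_sq_cases hm k hk with h | h | h | h | h | h
    · exact Or.inl h
    · exact Or.inr h.2
    all_goals omega
  have h0 := val x hx
  have h1 := val _ (mul_mem hG.expI_mem hx)
  rw [re_expI_mul] at h1
  norm_num at h1
  have hs := sum_sq_eq_one_sub_offCircle x
  have hn := offCircle_nonneg x
  have h1' : x.1.imI ^ 2 = 1 ∨ x.1.imI ^ 2 = 0 := by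
    rcases h1 with h | h
    · left; rcases h with h | h <;> nlinarith
    · right; rw [h]; norm_num
  rcases h0 with h0 | h0 <;> rcases h1' with h1 | h1 <;> rw [h0, h1] at hs
  · linarith
  · left; linarith
  · left; linarith
  · right; linarith

/-- An element of maximal real part in `⟨exp (iπ / n)⟩ x`. -/
theorem exists_maximal (hG : IsNormalPosition n G) [Finite G] {x : Sp1} (hx : x ∈ G)
    (h0 : offCircle x ≠ 0) : ∃ y ∈ G, offCircle y = offCircle x ∧ 0 ≤ y.1.re ∧
      y.1.re ≤ Real.cos (Real.pi / n) ∧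
      (1 - offCircle y) * (1 + Real.cos (Real.pi / n)) ≤ 2 * y.1.re ^ 2 := by
  have hE : Subgroup.zpowers (expI (Real.pi / n)) ≤ G := by
    rw [Subgroup.zpowers_le]; exact hG.expI_mem
  obtain ⟨e, he, hmax⟩ := exists_maximal_coset hE x
  obtain ⟨h1, h2⟩ := le_re_sq_of_maximal hG.cos_lt_one hmax
  have hy := mul_mem (hE he) hx
  refine ⟨e * x, hy, offCircle_mul_of_mem_zpowers _ he x, h1, hG.re_le _ hy fun h => h0 ?_, h2⟩
  rw [← offCircle_mul_of_mem_zpowers _ he x, h]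
  simp [offCircle]

/-- For `n = 3` and some element off both circles, `G` contains a pair with the real parts of the
generators of the binary tetrahedral group. -/
theorem exists_pair_three (hG : IsNormalPosition 3 G) [Finite G] {x : Sp1} (hx : x ∈ G)
    (h0 : offCircle x ≠ 0) (h1 : offCircle x ≠ 1) :
    ∃ b ∈ G, b.1.re = 1 / 2 ∧ (expI (Real.pi / (3 : ℕ)) * b).1.re = 0 := by
  have val : ∀ y ∈ G, y.1.re ^ 2 = 1 ∨ y.1.re ^ 2 = 0 ∨ y.1.re ^ 2 = 1 / 4 := by
    intro y hy
    obtain ⟨m, hm, hmn, k, hk⟩ := hG.re_eq y hy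
    rcases cos_sq_cases hm k hk with h | h | h | h | h | h
    · exact Or.inl h
    · exact Or.inr (Or.inl h.2)
    · exact Or.inr (Or.inr h.2)
    all_goals omega
  have hc : Real.cos (Real.pi / (3 : ℕ)) = 1 / 2 := by rw [Nat.cast_ofNat, Real.cos_pi_div_three]
  have ha := hG.expI_mem
  have hs : Real.sin (Real.pi / (3 : ℕ)) ^ 2 = 3 / 4 := by
    have := Real.cos_sq_add_sin_sq (Real.pi / (3 : ℕ))
    rw [hc] at this; linarith
  have hspos := hG.sin_pos
  have hu : offCircle x = 1 / 3 ∨ offCircle x = 2 / 3 := by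
    have hr := val _ (mul_mem (mul_mem (mul_mem ha hx) (inv_mem ha)) (inv_mem hx))
    rw [re_commutator_expI, hs] at hr
    have hn := offCircle_nonneg x
    have hlt : offCircle x < 1 := lt_of_le_of_ne
      (by nlinarith [sum_sq_eq_one_sub_offCircle x, sq_nonneg x.1.re, sq_nonneg x.1.imI]) h1
    have hn : 0 < offCircle x := lt_of_le_of_ne hn (Ne.symm h0)
    generalize offCircle x = u at *
    rcases hr with hr | hr | hr
    · exfalso; nlinarith
    · right; nlinarith
    · left
      have : (u - 1 / 3) * (u - 1) = 0 := by linarith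
      rcases mul_eq_zero.mp this with h | h
      · linarith
      · exact absurd h (by linarith)
  have hb := mul_mem (mul_mem hx ha) (inv_mem hx)
  -- both values of `offCircle x` lead to the same value for the conjugate of `exp (iπ / 3)`
  have hb2 : offCircle (x * expI (Real.pi / (3 : ℕ)) * x⁻¹) = 2 / 3 := by
    rw [offCircle_conj_expI, hs]
    rcases hu with h | h <;> rw [h] <;> norm_num
  obtain ⟨y, hy, e, y0, -, ymax⟩ := hG.exists_maximal hb (by rw [hb2]; norm_num)
  have hsum := sum_sq_eq_one_sub_offCircle y
  rw [e, hb2, hc] at ymax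
  rw [e, hb2] at hsum
  have yre : y.1.re = 1 / 2 := by
    rcases val y hy with h | h | h
    · nlinarith [sq_nonneg y.1.imI]
    · nlinarith
    · nlinarith
  have yim : (Real.sin (Real.pi / (3 : ℕ)) * y.1.imI) ^ 2 = (1 / 4) ^ 2 := by
    rw [mul_pow, hs]; rw [yre] at hsum; linarith
  have hay := re_expI_mul (Real.pi / (3 : ℕ)) y
  rw [hc, yre] at hay
  rcases sq_eq_sq_iff_eq_or_eq_neg.mp yim with h | h
  · exact ⟨y, hy, yre, by rw [hay, h]; norm_num⟩
  · refine ⟨_, mul_mem ha hy, by rw [hay, h]; norm_num, ?_⟩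
    rw [re_expI_mul_expI_mul, hay, h, hc, yre]; norm_num

/-- For `n = 4` and some element off both circles, `G` contains a pair with the real parts of the
generators of the binary octahedral group. -/
theorem exists_pair_four (hG : IsNormalPosition 4 G) [Finite G] {x : Sp1} (hx : x ∈ G)
    (h0 : offCircle x ≠ 0) (h1 : offCircle x ≠ 1) :
    ∃ b ∈ G, b.1.re = 1 / 2 ∧ (expI (Real.pi / (4 : ℕ)) * b).1.re = 0 := by
  have val : ∀ y ∈ G, y.1.re ^ 2 = 1 ∨ y.1.re ^ 2 = 0 ∨ y.1.re ^ 2 = 1 / 4 ∨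
      y.1.re ^ 2 = 1 / 2 := by
    intro y hy
    obtain ⟨m, hm, hmn, k, hk⟩ := hG.re_eq y hy
    rcases cos_sq_cases hm k hk with h | ⟨-, h⟩ | ⟨-, h⟩ | ⟨-, h⟩ | h | h
    · exact Or.inl h
    · exact Or.inr (Or.inl h)
    · exact Or.inr (Or.inr (Or.inl h))
    · rcases h with h | h <;> simp [h]
    all_goals omega
  have h2 : √2 ^ 2 = 2 := Real.sq_sqrt (by norm_num)
  have h2pos : (1.414 : ℝ) ≤ √2 := Real.le_sqrt_of_sq_le (by norm_num)
  have h2lt : √2 ≤ 1.415 := Real.sqrt_le_iff.mpr (by norm_num)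
  have hc : Real.cos (Real.pi / (4 : ℕ)) = √2 / 2 := by rw [Nat.cast_ofNat, Real.cos_pi_div_four]
  have ha := hG.expI_mem
  have hs : Real.sin (Real.pi / (4 : ℕ)) ^ 2 = 1 / 2 := by
    have := Real.cos_sq_add_sin_sq (Real.pi / (4 : ℕ))
    rw [hc] at this; nlinarith
  have hb := mul_mem (mul_mem hx ha) (inv_mem hx)
  have hu : offCircle x = 1 / 2 := by
    have hr := val _ (mul_mem (mul_mem (mul_mem ha hx) (inv_mem ha)) (inv_mem hx))
    have hr' := val _ (mul_mem (mul_mem (mul_mem ha hb) (inv_mem ha)) (inv_mem hb))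
    rw [re_commutator_expI, hs] at hr
    rw [re_commutator_expI, offCircle_conj_expI, hs] at hr'
    have hn := offCircle_nonneg x
    have hlt : offCircle x < 1 := lt_of_le_of_ne
      (by nlinarith [sum_sq_eq_one_sub_offCircle x, sq_nonneg x.1.re, sq_nonneg x.1.imI]) h1
    have hn : 0 < offCircle x := lt_of_le_of_ne hn (Ne.symm h0)
    generalize offCircle x = u at *
    rcases hr with hr | hr | hr | hr
    · nlinarith
    · nlinarith
    · nlinarith
    · exfalso
      have hu : u = 1 - √2 / 2 := by nlinarith
      -- the commutator of `exp (iπ / 4)` and its conjugate by `x` would have real part `2 - √2`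
      have : 1 - 2 * (1 / 2) * (4 * (1 / 2) * u * (1 - u)) = 2 - √2 := by
        rw [hu]; linear_combination (1 / 2) * h2
      rw [this] at hr'
      rcases hr' with h | h | h | h <;> nlinarith
  obtain ⟨y, hy, e, y0, -, ymax⟩ := hG.exists_maximal hx h0
  have hsum := sum_sq_eq_one_sub_offCircle y
  rw [e, hu, hc] at ymax
  rw [e, hu] at hsum
  have yre2 : y.1.re ^ 2 = 1 / 2 := by
    rcases val y hy with h | h | h | h
    · nlinarith [sq_nonneg y.1.imI]
    · nlinarith
    · nlinarith
    · exact h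
  have yre : y.1.re = √2 / 2 := (sq_eq_sq₀ y0 (by positivity)).mp (by rw [yre2]; linarith)
  have yim : y.1.imI = 0 := pow_eq_zero_iff (two_ne_zero) |>.mp (by linarith)
  have hay : (expI (Real.pi / (4 : ℕ)) * y).1.re = 1 / 2 := by
    rw [re_expI_mul, hc, yre, yim]; linarith
  refine ⟨_, mul_mem ha hy, hay, ?_⟩
  rw [re_expI_mul_expI_mul, hay, hc, yre]; ring

theorem re_sq_five (hG : IsNormalPosition 5 G) {p : ℝ} (hp2 : p ^ 2 = p + 1) :
    ∀ y ∈ G, y.1.re ^ 2 = 1 ∨ y.1.re ^ 2 = 0 ∨ y.1.re ^ 2 = 1 / 4 ∨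
      y.1.re ^ 2 = 1 / 2 ∨ y.1.re ^ 2 = p ^ 2 / 4 ∨ y.1.re ^ 2 = (p - 1) ^ 2 / 4 := by
  intro y hy
  obtain ⟨m, hm, hmn, k, hk⟩ := hG.re_eq y hy
  rcases cos_sq_cases hm k hk with h | ⟨-, h⟩ | ⟨-, h⟩ | ⟨-, h⟩ | ⟨-, h⟩ | h
  · exact Or.inl h
  · exact Or.inr (Or.inl h)
  · exact Or.inr (Or.inr (Or.inl h))
  · rcases h with h | h <;> simp [h]
  · have : (y.1.re ^ 2 - p ^ 2 / 4) * (y.1.re ^ 2 - (p - 1) ^ 2 / 4) = 0 := by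
      have e1 : (p - 1) ^ 2 = 2 - p := by linear_combination hp2
      rw [e1, hp2]
      linear_combination h / 16 - hp2 / 16
    rcases mul_eq_zero.mp this with h | h
    · right; right; right; right; left; linarith
    · right; right; right; right; right; linarith
  · omega

/-- Some `b ∈ G` has `|z|² = 1 / (3 - φ)`: the axis of `b a b⁻¹`, `a = exp (iπ / 5)`, makes with
that of `a` the angle between adjacent vertices of an icosahedron. -/
theorem exists_offCircle_five (hG : IsNormalPosition 5 G) {x : Sp1} (hx : x ∈ G)
    (h0 : offCircle x ≠ 0) (h1 : offCircle x ≠ 1) :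
    ∃ b ∈ G, (3 - Real.goldenRatio) * (1 - offCircle b) = 1 := by
  have hs := sin_sq_pi_div_five
  have hp2 := Real.goldenRatio_sq
  obtain ⟨hplo, hphi⟩ := goldenRatio_bounds
  generalize Real.goldenRatio = p at *
  have val := hG.re_sq_five hp2
  have h2 : √2 ^ 2 = 2 := Real.sq_sqrt (by norm_num)
  have h2pos : (1.414 : ℝ) ≤ √2 := Real.le_sqrt_of_sq_le (by norm_num)
  have h2lt : √2 ≤ 1.415 := Real.sqrt_le_iff.mpr (by norm_num)
  have ha := hG.expI_mem
  have hb := mul_mem (mul_mem hx ha) (inv_mem hx)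
  refine ⟨_, hb, ?_⟩
  have hr := val _ (mul_mem (mul_mem (mul_mem ha hx) (inv_mem ha)) (inv_mem hx))
  have hr' := val _ (mul_mem (mul_mem (mul_mem ha hb) (inv_mem ha)) (inv_mem hb))
  rw [re_commutator_expI, hs] at hr
  rw [re_commutator_expI, offCircle_conj_expI, hs] at hr'
  rw [offCircle_conj_expI, hs]
  have hn := offCircle_nonneg x
  have hlt : offCircle x < 1 := lt_of_le_of_ne
    (by nlinarith [sum_sq_eq_one_sub_offCircle x, sq_nonneg x.1.re, sq_nonneg x.1.imI]) h1
  have hn : 0 < offCircle x := lt_of_le_of_ne hn (Ne.symm h0)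
  generalize offCircle x = u at *
  obtain ⟨r, hrdef⟩ : ∃ r, r = 1 - 2 * ((3 - p) / 4) * u := ⟨_, rfl⟩
  rw [← hrdef] at hr
  have r1 : r < 1 := by nlinarith
  have r0 : (p - 1) / 2 < r := by nlinarith
  have r00 : 0 < r := by linarith
  have hr'' : 1 - 2 * ((3 - p) / 4) * (4 * ((3 - p) / 4) * u * (1 - u)) =
      1 - (1 - r) * (1 - p + 2 * r) := by rw [hrdef]; ring
  rw [hr''] at hr'
  have fin : ∀ w : ℝ, 0 ≤ w → r ^ 2 = w ^ 2 → r = w := fun w hw h =>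
    (sq_eq_sq₀ r00.le hw).mp h
  rcases hr with hr | hr | hr | hr | hr | hr
  · nlinarith
  · nlinarith
  · have := fin (1 / 2) (by norm_num) (by rw [hr]; norm_num)
    have hu : (3 - p) * u = 1 := by rw [this] at hrdef; linarith
    linear_combination (1 - (3 - p) * (1 - u)) * hu
  · exfalso
    have := fin (√2 / 2) (by positivity) (by rw [hr]; linarith)
    -- the real part of the next commutator would lie strictly between `1 / √2` and `φ / 2`
    have t1 : (1 - r) * (1 - p + 2 * r) ≤ 0.293 * 0.797 :=
      mul_le_mul (by linarith) (by linarith) (by linarith) (by norm_num)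
    have t2 : 0.2925 * 0.7955 ≤ (1 - r) * (1 - p + 2 * r) :=
      mul_le_mul (by linarith) (by linarith) (by norm_num) (by linarith)
    have l1 : 0.76 < 1 - (1 - r) * (1 - p + 2 * r) := by linarith
    have l2 : 1 - (1 - r) * (1 - p + 2 * r) < 0.77 := by linarith
    generalize 1 - (1 - r) * (1 - p + 2 * r) = q at hr' l1 l2
    have q1 : 0.76 ^ 2 < q ^ 2 := by gcongr
    have q2 : q ^ 2 < 0.77 ^ 2 := by gcongr
    norm_num at q1 q2
    have p1 : (p - 1) ^ 2 = 2 - p := by linear_combination hp2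
    rw [p1, hp2] at hr'
    rcases hr' with h | h | h | h | h | h <;> linarith
  · have := fin (p / 2) (by linarith) (by rw [hr]; ring)
    have hu : (3 - p) * u = 2 - p := by rw [this] at hrdef; linarith
    linear_combination ((3 - p) * u - 1) * hu
  · have := fin ((p - 1) / 2) (by linarith) (by rw [hr]; ring)
    linarith

/-- For `n = 5` and some element off both circles, `G` contains a pair with the real parts of the
generators of the binary icosahedral group. -/
theorem exists_pair_five (hG : IsNormalPosition 5 G) [Finite G] {x : Sp1} (hx : x ∈ G)
    (h0 : offCircle x ≠ 0) (h1 : offCircle x ≠ 1) :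
    ∃ b ∈ G, b.1.re = 1 / 2 ∧ (expI (Real.pi / (5 : ℕ)) * b).1.re = 0 := by
  have ha := hG.expI_mem
  have hs := sin_sq_pi_div_five
  have hc := cos_pi_div_five_cast
  have hp2 := Real.goldenRatio_sq
  obtain ⟨hplo, hphi⟩ := goldenRatio_bounds
  obtain ⟨b, hb, hu⟩ := hG.exists_offCircle_five hx h0 h1
  generalize Real.goldenRatio = p at *
  have hb0 : offCircle b ≠ 0 := fun h => by rw [h] at hu; linarith
  obtain ⟨y, hy, e, y0, yle, ymax⟩ := hG.exists_maximal hb hb0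
  have hsum := sum_sq_eq_one_sub_offCircle y
  rw [e, hc] at ymax
  rw [e] at hsum
  rw [hc] at yle
  have yre : y.1.re = p / 2 := by
    apply le_antisymm yle
    refine (sq_le_sq₀ (by linarith) y0).mp ?_
    have h3 : (3 - p) * (p / 2) ^ 2 ≤ (3 - p) * y.1.re ^ 2 := by
      have := mul_le_mul_of_nonneg_left ymax (by linarith : (0 : ℝ) ≤ 3 - p)
      have e1 : (3 - p) * (p / 2) ^ 2 = (1 + p / 2) / 2 := by
        linear_combination ((2 - p) / 4) * hp2
      rw [← mul_assoc, hu] at this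
      linarith
    exact le_of_mul_le_mul_left h3 (by linarith)
  have yim : (Real.sin (Real.pi / (5 : ℕ)) * y.1.imI) ^ 2 = ((p - 1) / 4) ^ 2 := by
    rw [mul_pow, hs]; rw [yre] at hsum
    linear_combination (3 - p) / 4 * hsum + hu / 4 + (p - 3) / 16 * hp2
  have hay := re_expI_mul (Real.pi / (5 : ℕ)) y
  rw [hc, yre] at hay
  have haay := re_expI_mul_expI_mul (Real.pi / (5 : ℕ)) y
  rw [hc, yre] at haay
  rcases sq_eq_sq_iff_eq_or_eq_neg.mp yim with h | h
  · have hay' : (expI (Real.pi / (5 : ℕ)) * y).1.re = 1 / 2 := by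
      rw [hay, h]; linear_combination hp2 / 4
    exact ⟨_, mul_mem ha hy, hay', by rw [haay, hay']; ring⟩
  · have hay' : (expI (Real.pi / (5 : ℕ)) * y).1.re = p / 2 := by
      rw [hay, h]; linear_combination hp2 / 4
    have haay' : (expI (Real.pi / (5 : ℕ)) * (expI (Real.pi / (5 : ℕ)) * y)).1.re = 1 / 2 := by
      rw [haay, hay']; linear_combination hp2 / 2
    refine ⟨_, mul_mem ha (mul_mem ha hy), haay', ?_⟩
    rw [re_expI_mul_expI_mul, haay', hay', hc]; ring

end IsNormalPosition

/-! ### The binary polyhedral groups -/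

/-- The quaternion `i`. -/
noncomputable def unitI : Sp1 := unitQuat 0 1 0 0 (by norm_num)

/-- Conjugation by `i` and `j` and inversion change the signs of the imaginary components of `e`
in all possible ways, so the coset condition bounds the sum of absolute values. -/
theorem abs_le_of_maximal {E : Subgroup Sp1} (hi : unitI ∈ E) (hj : quatJ ∈ E) {y : Sp1}
    (hmax : ∀ e ∈ E, (e * y).1.re ≤ y.1.re) {e : Sp1} (he : e ∈ E) :
    e.1.re * y.1.re + (|e.1.imI * y.1.imI| + |e.1.imJ * y.1.imJ| + |e.1.imK * y.1.imK|)
      ≤ y.1.re := by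
  have conj_i : ∀ x ∈ E, ∃ z ∈ E, z.1.re = x.1.re ∧ z.1.imI = x.1.imI ∧ z.1.imJ = -x.1.imJ ∧
      z.1.imK = -x.1.imK := fun x hx =>
    ⟨unitI * x * unitI⁻¹, mul_mem (mul_mem hi hx) (inv_mem hi), by
      simp [coe_inv_Sp1, unitI, coe_unitQuat]⟩
  have conj_j : ∀ x ∈ E, ∃ z ∈ E, z.1.re = x.1.re ∧ z.1.imI = -x.1.imI ∧ z.1.imJ = x.1.imJ ∧
      z.1.imK = -x.1.imK := fun x hx =>
    ⟨quatJ * x * quatJ⁻¹, mul_mem (mul_mem hj hx) (inv_mem hj), by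
      simp [coe_inv_Sp1, quatJ, coe_unitQuat]⟩
  have both : ∀ x ∈ E, x.1.re * y.1.re - x.1.imI * y.1.imI - x.1.imJ * y.1.imJ -
      x.1.imK * y.1.imK ≤ y.1.re ∧ x.1.re * y.1.re + x.1.imI * y.1.imI + x.1.imJ * y.1.imJ +
      x.1.imK * y.1.imK ≤ y.1.re := by
    intro x hx
    have h1 := hmax x hx
    have h2 := hmax _ (inv_mem hx)
    simp only [coe_mul_Sp1, coe_inv_Sp1, Quaternion.re_mul, Quaternion.re_star,
      Quaternion.imI_star, Quaternion.imJ_star, Quaternion.imK_star] at h1 h2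
    constructor <;> linarith
  obtain ⟨e1, he1, a0, a1, a2, a3⟩ := conj_i e he
  obtain ⟨e2, he2, b0, b1, b2, b3⟩ := conj_j e he
  obtain ⟨e3, he3, c0, c1, c2, c3⟩ := conj_i e2 he2
  have d0 := both e he
  have d1 := both e1 he1
  have d2 := both e2 he2
  have d3 := both e3 he3
  rw [a0, a1, a2, a3] at d1
  rw [c0, c1, c2, c3] at d3
  rw [b0, b1, b2, b3] at d2 d3
  rcases abs_cases (e.1.imI * y.1.imI) with ⟨h1, -⟩ | ⟨h1, -⟩ <;>
  rcases abs_cases (e.1.imJ * y.1.imJ) with ⟨h2, -⟩ | ⟨h2, -⟩ <;>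
  rcases abs_cases (e.1.imK * y.1.imK) with ⟨h3, -⟩ | ⟨h3, -⟩ <;>
  rw [h1, h2, h3] <;> linarith [d0.1, d0.2, d1.1, d1.2, d2.1, d2.2, d3.1, d3.2]

/-- Conjugation by `(1 + i + j + k) / 2` permutes `i`, `j`, `k` cyclically. -/
theorem conj_quatS_mem {E : Subgroup Sp1} (hS : quatS ∈ E) {e : Sp1} (he : e ∈ E) :
    ∃ z ∈ E, z.1.re = e.1.re ∧ z.1.imI = e.1.imK ∧ z.1.imJ = e.1.imI ∧ z.1.imK = e.1.imJ := by
  refine ⟨quatS * e * quatS⁻¹, mul_mem (mul_mem hS he) (inv_mem hS), re_conj _ _, ?_⟩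
  simp only [coe_mul_Sp1, coe_inv_Sp1, quatS, coe_unitQuat, Quaternion.re_mul, Quaternion.imI_mul,
    Quaternion.imJ_mul, Quaternion.imK_mul, Quaternion.re_star, Quaternion.imI_star,
    Quaternion.imJ_star, Quaternion.imK_star, quat_re, quat_imI, quat_imJ, quat_imK]
  refine ⟨?_, ?_, ?_⟩ <;> ring

/-- Bounds for an element of maximal real part in its coset of a group that contains the
quaternion units: conjugation by `(1 + i + j + k) / 2` permutes `i`, `j`, `k` cyclically. -/
theorem cyclic_abs_le_of_maximal {E : Subgroup Sp1} (hi : unitI ∈ E) (hj : quatJ ∈ E)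
    (hS : quatS ∈ E) {y : Sp1} (hmax : ∀ e ∈ E, (e * y).1.re ≤ y.1.re) {e : Sp1} (he : e ∈ E) :
    e.1.re * y.1.re + (|e.1.imI| * |y.1.imI| + |e.1.imJ| * |y.1.imJ| + |e.1.imK| * |y.1.imK|)
      ≤ y.1.re ∧
    e.1.re * y.1.re + (|e.1.imK| * |y.1.imI| + |e.1.imI| * |y.1.imJ| + |e.1.imJ| * |y.1.imK|)
      ≤ y.1.re ∧
    e.1.re * y.1.re + (|e.1.imJ| * |y.1.imI| + |e.1.imK| * |y.1.imJ| + |e.1.imI| * |y.1.imK|)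
      ≤ y.1.re := by
  obtain ⟨e1, he1, a0, a1, a2, a3⟩ := conj_quatS_mem hS he
  obtain ⟨e2, he2, b0, b1, b2, b3⟩ := conj_quatS_mem hS he1
  have h0 := abs_le_of_maximal hi hj hmax he
  have h1 := abs_le_of_maximal hi hj hmax he1
  have h2 := abs_le_of_maximal hi hj hmax he2
  simp only [abs_mul, b0, b1, b2, b3, a0, a1, a2, a3] at h0 h1 h2
  exact ⟨h0, h1, h2⟩

theorem sum_abs_le_of_maximal {E : Subgroup Sp1} (hi : unitI ∈ E) (hj : quatJ ∈ E)
    (hS : quatS ∈ E) {y : Sp1} (hmax : ∀ e ∈ E, (e * y).1.re ≤ y.1.re) :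
    |y.1.imI| ≤ y.1.re ∧ |y.1.imJ| ≤ y.1.re ∧ |y.1.imK| ≤ y.1.re ∧
      |y.1.imI| + |y.1.imJ| + |y.1.imK| ≤ y.1.re := by
  obtain ⟨h1, h2, h3⟩ := cyclic_abs_le_of_maximal hi hj hS hmax hi
  obtain ⟨h4, -⟩ := cyclic_abs_le_of_maximal hi hj hS hmax hS
  simp only [unitI, quatS, coe_unitQuat, quat_re, quat_imI, quat_imJ, quat_imK, abs_zero, abs_one]
    at h1 h2 h3 h4
  rw [abs_of_pos (by norm_num : (0 : ℝ) < 1 / 2)] at h4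
  refine ⟨?_, ?_, ?_, ?_⟩ <;> linarith

theorem sum_sq_abs (y : Sp1) :
    y.1.re ^ 2 + |y.1.imI| ^ 2 + |y.1.imJ| ^ 2 + |y.1.imK| ^ 2 = 1 := by
  simp only [sq_abs]; exact sum_sq_Sp1 y

/-- If `x ≠ 1` in `G` forces `Re x ≤ c`, then an element of large real part is `1`. -/
theorem eq_one_of_sq_lt {G : Subgroup Sp1} {c : ℝ} (hc : 0 ≤ c)
    (hle : ∀ x ∈ G, x ≠ 1 → x.1.re ≤ c) {y : Sp1} (hy : y ∈ G) (h0 : 0 ≤ y.1.re)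
    (h : c ^ 2 < y.1.re ^ 2) : y = 1 := by
  by_contra hne
  exact absurd (hle y hy hne) (not_le.mpr ((sq_lt_sq₀ hc h0).mp h))

theorem unitI_quatJ_mem_E6 : unitI ∈ Subgroup.closure {quatS, quatS'} ∧
    quatJ ∈ Subgroup.closure {quatS, quatS'} := by
  have hS : quatS ∈ Subgroup.closure {quatS, quatS'} := Subgroup.subset_closure (by simp)
  have hS' : quatS' ∈ Subgroup.closure {quatS, quatS'} := Subgroup.subset_closure (by simp)
  constructor
  · have : unitI = quatS' * quatS := by
      apply Sp1_ext <;> simp [unitI, quatS, quatS', coe_unitQuat] <;> norm_num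
    rw [this]; exact mul_mem hS' hS
  · have : quatJ = quatS * quatS' := by
      apply Sp1_ext <;> simp [quatJ, quatS, quatS', coe_unitQuat] <;> norm_num
    rw [this]; exact mul_mem hS hS'

theorem unitI_quatJ_mem_E7 : unitI ∈ Subgroup.closure {quatS, quatO} ∧
    quatJ ∈ Subgroup.closure {quatS, quatO} := by
  have hS : quatS ∈ Subgroup.closure {quatS, quatO} := Subgroup.subset_closure (by simp)
  have hO : quatO ∈ Subgroup.closure {quatS, quatO} := Subgroup.subset_closure (by simp)
  have h2 : (√2)⁻¹ * (√2)⁻¹ = 1 / 2 := by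
    rw [← mul_inv, Real.mul_self_sqrt zero_le_two, one_div]
  have hi : unitI ∈ Subgroup.closure {quatS, quatO} := by
    have : unitI = quatO * quatO := by
      apply Sp1_ext <;> simp [unitI, quatO, coe_unitQuat]; linarith
    rw [this]; exact mul_mem hO hO
  refine ⟨hi, ?_⟩
  have : quatJ = quatS * unitI * quatS⁻¹ := by
    apply Sp1_ext <;> simp [quatJ, quatS, unitI, coe_unitQuat, coe_inv_Sp1]; norm_num
  rw [this]; exact mul_mem (mul_mem hS hi) (inv_mem hS)

theorem inv_goldenRatio_eq : Real.goldenRatio⁻¹ = Real.goldenRatio - 1 := by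
  rw [Real.inv_goldenRatio]; linarith [Real.goldenRatio_add_goldenConj]

theorem unitI_quatJ_mem_E8 : unitI ∈ Subgroup.closure {quatS, quatI} ∧
    quatJ ∈ Subgroup.closure {quatS, quatI} := by
  have hS : quatS ∈ Subgroup.closure {quatS, quatI} := Subgroup.subset_closure (by simp)
  have hI : quatI ∈ Subgroup.closure {quatS, quatI} := Subgroup.subset_closure (by simp)
  have hp := Real.goldenRatio_sq
  have hp' := inv_goldenRatio_eq
  constructor
  · have : unitI * quatI = quatI * quatS * quatI⁻¹ * quatS := by
      apply Sp1_ext <;>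
        simp only [unitI, quatS, quatI, coe_unitQuat, coe_inv_Sp1, coe_mul_Sp1, Quaternion.re_mul,
          Quaternion.imI_mul, Quaternion.imJ_mul, Quaternion.imK_mul, Quaternion.re_star,
          Quaternion.imI_star, Quaternion.imJ_star, Quaternion.imK_star, quat_re, quat_imI,
          quat_imJ, quat_imK, hp'] <;> grind
    rw [eq_mul_inv_of_mul_eq this]
    exact mul_mem (mul_mem (mul_mem (mul_mem hI hS) (inv_mem hI)) hS) (inv_mem hI)
  · have : quatI * quatJ = quatS * quatI * quatI := by
      apply Sp1_ext <;>
        simp only [quatJ, quatS, quatI, coe_unitQuat, coe_mul_Sp1, Quaternion.re_mul,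
          Quaternion.imI_mul, Quaternion.imJ_mul, Quaternion.imK_mul, quat_re, quat_imI,
          quat_imJ, quat_imK, hp'] <;> grind
    rw [eq_inv_mul_of_mul_eq this]
    exact mul_mem (inv_mem hI) (mul_mem (mul_mem hS hI) hI)

/-- An element of maximal real part in its coset of the binary tetrahedral group has
`(Re y)² ≥ 1/2`: every point of the `3`-sphere is within `45°` of a vertex of the `24`-cell. -/
theorem le_closure_E6 {G : Subgroup Sp1} [Finite G] (hE : Subgroup.closure {quatS, quatS'} ≤ G)
    (hle : ∀ x ∈ G, x ≠ 1 → x.1.re ≤ 1 / 2) : G ≤ Subgroup.closure {quatS, quatS'} := by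
  refine le_of_maximal_eq_one hE fun y hy hmax => ?_
  obtain ⟨hi, hj⟩ := unitI_quatJ_mem_E6
  have hS : quatS ∈ Subgroup.closure {quatS, quatS'} := Subgroup.subset_closure (by simp)
  obtain ⟨h1, h2, h3, h4⟩ := sum_abs_le_of_maximal hi hj hS hmax
  have hs := sum_sq_abs y
  have hp : 0 ≤ y.1.re := (abs_nonneg _).trans h1
  refine eq_one_of_sq_lt (by norm_num) hle hy hp ?_
  nlinarith [mul_nonneg (sub_nonneg.mpr h1) (abs_nonneg y.1.imI),
    mul_nonneg (sub_nonneg.mpr h2) (abs_nonneg y.1.imJ),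
    mul_nonneg (sub_nonneg.mpr h3) (abs_nonneg y.1.imK),
    mul_nonneg (sub_nonneg.mpr h4) hp]

/-- An element of maximal real part in its coset of the binary octahedral group has `(Re y)² > 1/2`,
by its position relative to `(1 ± i)/√2`, `(1 ± j)/√2`, `(1 ± k)/√2`. -/
theorem le_closure_E7 {G : Subgroup Sp1} [Finite G] (hE : Subgroup.closure {quatS, quatO} ≤ G)
    (hle : ∀ x ∈ G, x ≠ 1 → x.1.re ≤ √2 / 2) : G ≤ Subgroup.closure {quatS, quatO} := by
  refine le_of_maximal_eq_one hE fun y hy hmax => ?_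
  obtain ⟨hi, hj⟩ := unitI_quatJ_mem_E7
  have hS : quatS ∈ Subgroup.closure {quatS, quatO} := Subgroup.subset_closure (by simp)
  have hO : quatO ∈ Subgroup.closure {quatS, quatO} := Subgroup.subset_closure (by simp)
  obtain ⟨h1, -⟩ := sum_abs_le_of_maximal hi hj hS hmax
  have hp : 0 ≤ y.1.re := (abs_nonneg _).trans h1
  have hs := sum_sq_abs y
  obtain ⟨b1, b2, b3⟩ := cyclic_abs_le_of_maximal hi hj hS hmax hO
  have h2 : √2 ^ 2 = 2 := Real.sq_sqrt (by norm_num)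
  have h2lt : √2 ≤ 1.415 := Real.sqrt_le_iff.mpr (by norm_num)
  have hpos : 0 < √2 := by positivity
  simp only [quatO, coe_unitQuat, quat_re, quat_imI, quat_imJ, quat_imK, abs_zero, zero_mul,
    add_zero, zero_add, abs_of_pos (by positivity : (0 : ℝ) < 1 / √2)] at b1 b2 b3
  have bound : ∀ q : ℝ, 1 / √2 * y.1.re + 1 / √2 * q ≤ y.1.re → q ≤ 0.415 * y.1.re := by
    intro q hq
    have := mul_le_mul_of_nonneg_left hq hpos.le
    rw [show √2 * (1 / √2 * y.1.re + 1 / √2 * q) = y.1.re + q by field_simp] at this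
    nlinarith
  have sq_bound : ∀ q : ℝ, 0 ≤ q → 1 / √2 * y.1.re + 1 / √2 * q ≤ y.1.re →
      q ^ 2 ≤ (0.415 * y.1.re) ^ 2 := fun q h0 hq => pow_le_pow_left₀ h0 (bound q hq) 2
  have c1 := sq_bound _ (abs_nonneg _) b1
  have c2 := sq_bound _ (abs_nonneg _) b2
  have c3 := sq_bound _ (abs_nonneg _) b3
  refine eq_one_of_sq_lt (by positivity) hle hy hp ?_
  rw [div_pow, h2]
  nlinarith

/-- An element of maximal real part in its coset of the binary icosahedral group has
`(Re y)² > (φ/2)²`, by its position relative to the `12` vertices of the `600`-cell adjacent to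
`1`. -/
theorem le_closure_E8 {G : Subgroup Sp1} [Finite G] (hE : Subgroup.closure {quatS, quatI} ≤ G)
    (hle : ∀ x ∈ G, x ≠ 1 → x.1.re ≤ Real.goldenRatio / 2) :
    G ≤ Subgroup.closure {quatS, quatI} := by
  refine le_of_maximal_eq_one hE fun y hy hmax => ?_
  obtain ⟨hi, hj⟩ := unitI_quatJ_mem_E8
  have hS : quatS ∈ Subgroup.closure {quatS, quatI} := Subgroup.subset_closure (by simp)
  have hI : quatI ∈ Subgroup.closure {quatS, quatI} := Subgroup.subset_closure (by simp)
  have hp : 0 ≤ y.1.re := (abs_nonneg _).trans (sum_abs_le_of_maximal hi hj hS hmax).1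
  have hs := sum_sq_abs y
  obtain ⟨b1, b2, b3⟩ := cyclic_abs_le_of_maximal hi hj hS hmax hI
  obtain ⟨hlo, hhi⟩ := goldenRatio_bounds
  refine eq_one_of_sq_lt (by linarith) hle hy hp ?_
  simp only [quatI, coe_unitQuat, quat_re, quat_imI, quat_imJ, quat_imK,
    inv_goldenRatio_eq] at b1 b2 b3
  generalize Real.goldenRatio = g at b1 b2 b3 hlo hhi ⊢
  rw [abs_of_pos (by linarith : 0 < (g - 1) / 2), abs_of_pos (by norm_num : (0 : ℝ) < 1 / 2),
    abs_zero] at b1 b2 b3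
  have q0 := abs_nonneg y.1.imI
  have r0 := abs_nonneg y.1.imJ
  have s0 := abs_nonneg y.1.imK
  generalize |y.1.imI| = q at b1 b2 b3 hs q0
  generalize |y.1.imJ| = r at b1 b2 b3 hs r0
  generalize |y.1.imK| = s at b1 b2 b3 hs s0
  generalize y.1.re = p at b1 b2 b3 hs hp ⊢
  have d : ∀ {t : ℝ}, 0 ≤ t → 0.618 * t ≤ (g - 1) * t := fun ht => by nlinarith
  have gp : 1.618 * p ≤ g * p := by nlinarith
  have c1 : 0.618 * q + r ≤ 0.382 * p := by linarith [d q0]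
  have c2 : 0.618 * r + s ≤ 0.382 * p := by linarith [d r0]
  have c3 : 0.618 * s + q ≤ 0.382 * p := by linarith [d s0]
  have e1 : q + r + s ≤ 0.7084 * p := by linarith
  have e2 : q ^ 2 + r ^ 2 + s ^ 2 ≤ 0.382 * p * (q + r + s) := by
    nlinarith [mul_nonneg q0 (by linarith : 0 ≤ 0.382 * p - q),
      mul_nonneg r0 (by linarith : 0 ≤ 0.382 * p - r),
      mul_nonneg s0 (by linarith : 0 ≤ 0.382 * p - s)]
  have e3 : 0.382 * p * (q + r + s) ≤ 0.382 * p * (0.7084 * p) :=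
    mul_le_mul_of_nonneg_left e1 (by linarith)
  have e4 : 0.78 < p ^ 2 := by nlinarith
  have e5 : (g / 2) ^ 2 ≤ (1.6185 / 2) ^ 2 := by gcongr
  norm_num at e5
  linarith

/-! ### Classification of the finite subgroups of `Sp(1)` -/

theorem exists_sq_eq_neg_one {G : Subgroup Sp1} {h : Sp1} (hj : quatJ ∈ MulAut.conj h • G) :
    ∃ x ∈ G, x * x = -1 := by
  refine ⟨_, mem_conj_smul.mp hj, ?_⟩
  have : quatJ * quatJ = -1 := by
    apply Sp1_ext <;> simp [quatJ, coe_unitQuat, coe_neg_Sp1]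
  calc h⁻¹ * quatJ * h * (h⁻¹ * quatJ * h) = h⁻¹ * (quatJ * quatJ) * h := by group
    _ = -1 := by rw [this]; simp

/-- A finite group containing `-1` is conjugate to a subgroup of the circle or is conjugate to
one of the groups `D` and `E`. -/
theorem circle_or_isADE_of_neg_one_mem (G : Subgroup Sp1) [Finite G] (hneg : -1 ∈ G) :
    (∃ h : Sp1, ∀ x ∈ MulAut.conj h • G, x.1.imJ = 0 ∧ x.1.imK = 0) ∨
      ((∃ h : Sp1, IsADE (MulAut.conj h • G)) ∧ ∃ x ∈ G, x * x = -1) := by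
  obtain ⟨n, hn, ⟨a, ha, hare⟩, hle, hval⟩ := exists_max_re G hneg
  rcases Nat.lt_or_ge n 2 with h2 | h2
  · left
    obtain rfl : n = 1 := by omega
    refine ⟨1, fun x hx => ?_⟩
    rw [map_one, one_smul] at hx
    by_cases h1 : x = 1
    · simp [h1]
    · have := hle x hx h1
      rw [Nat.cast_one, div_one, Real.cos_pi] at this
      have h3 : -x = 1 := eq_one_of_re_eq_one (le_antisymm (re_le_one _) (by
        rw [coe_neg_Sp1, Quaternion.re_neg]; linarith))
      rw [← neg_neg x, h3]; simp [coe_neg_Sp1]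
  obtain ⟨h, hJ, hK, hI⟩ := exists_conj_circle a
  have hG : IsNormalPosition n (MulAut.conj h • G) := by
    have hre : ∀ x, (h⁻¹ * x * h).1.re = x.1.re := fun x => by
      have := re_conj h⁻¹ x
      rwa [inv_inv] at this
    have e : h * a * h⁻¹ = expI (Real.pi / n) := by
      have hs := sum_sq_Sp1 (h * a * h⁻¹)
      have hr : (h * a * h⁻¹).1.re = Real.cos (Real.pi / n) := by rw [re_conj, hare]
      refine Sp1_ext hr ?_ hJ hK
      have hn' : (1 : ℝ) ≤ n := by exact_mod_cast hn
      have hsin : 0 ≤ Real.sin (Real.pi / n) := Real.sin_nonneg_of_nonneg_of_le_pi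
        (by have := Real.pi_pos; positivity) (div_le_self Real.pi_pos.le hn')
      rw [hr, hJ, hK] at hs
      exact (sq_eq_sq₀ hI hsin).mp (by linarith [Real.cos_sq_add_sin_sq (Real.pi / n)])
    refine ⟨?_, h2, ?_, fun x hx h1 => ?_, fun x hx => ?_⟩
    · rw [mem_conj_smul]; simpa using hneg
    · rw [mem_conj_smul, ← e]; simpa [mul_assoc] using ha
    · rw [← hre]
      refine hle _ (mem_conj_smul.mp hx) fun e => h1 ?_
      rw [mul_assoc, inv_mul_eq_one] at e; simpa using e.symm
    · rw [← hre]; exact hval _ (mem_conj_smul.mp hx)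
  have back : ∀ k : Sp1, MulAut.conj k • MulAut.conj h • G = MulAut.conj (k * h) • G := fun k => by
    rw [smul_smul, map_mul]
  by_cases H : ∀ x ∈ MulAut.conj h • G, offCircle x = 0 ∨ offCircle x = 1
  · rcases hG.cyclic_or_dihedral H with hc | ⟨k, hk⟩
    · exact Or.inl ⟨h, hc⟩
    · right
      rw [back] at hk
      refine ⟨⟨k * h, hk ▸ IsADE.D n h2⟩, exists_sq_eq_neg_one (h := k * h) ?_⟩
      rw [hk]
      exact Subgroup.subset_closure (Set.mem_insert _ _)
  right
  push Not at H
  obtain ⟨x, hx, x0, x1⟩ := H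
  -- it suffices to find a pair of elements conjugate to the generators of a polyhedral group
  have key : ∀ X : Sp1, X.1.re = Real.cos (Real.pi / n) → (X * quatS).1.re = 0 →
      IsADE (Subgroup.closure {quatS, X}) → quatJ ∈ Subgroup.closure {quatS, X} →
      (∃ b ∈ MulAut.conj h • G, b.1.re = 1 / 2 ∧ (expI (Real.pi / n) * b).1.re = 0) →
      (∀ K : Subgroup Sp1, Finite K → Subgroup.closure {quatS, X} ≤ K →
        (∀ x ∈ K, x ≠ 1 → x.1.re ≤ Real.cos (Real.pi / n)) →
        K ≤ Subgroup.closure {quatS, X}) →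
      (∃ h : Sp1, IsADE (MulAut.conj h • G)) ∧ ∃ x ∈ G, x * x = -1 := by
    rintro X hX hXS hade hj ⟨b, hb, hbre, hab⟩ hmaximal
    obtain ⟨k, hka, hkb⟩ := exists_conj_pair (a := expI (Real.pi / n)) (b := b) (a' := X)
      (b' := quatS) (by
        change Real.cos (Real.pi / n) ^ 2 ≠ 1
        intro e
        nlinarith [hG.cos_nonneg, hG.cos_lt_one]) hX.symm hbre (hab.trans hXS.symm)
    have hcl : Subgroup.closure {quatS, X} ≤ MulAut.conj k • MulAut.conj h • G := by
      rw [Subgroup.closure_le, Set.insert_subset_iff, Set.singleton_subset_iff]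
      constructor
      · rw [SetLike.mem_coe, mem_conj_smul, ← hkb]; simpa [mul_assoc] using hb
      · rw [SetLike.mem_coe, mem_conj_smul, ← hka]; simpa [mul_assoc] using hG.expI_mem
    have hle' := hmaximal _ inferInstance hcl (fun x hx h1 => by
      have := re_conj k⁻¹ x
      rw [inv_inv] at this
      rw [← this]
      refine hG.re_le _ (mem_conj_smul.mp hx) fun e => h1 ?_
      rw [mul_assoc, inv_mul_eq_one] at e; simpa using e.symm)
    have heq := le_antisymm hle' hcl
    rw [back] at heq
    exact ⟨⟨k * h, by rw [heq]; exact hade⟩, exists_sq_eq_neg_one (h := k * h) (by rwa [heq])⟩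
  have hn5 : n ≤ 5 := by
    by_contra hlt
    rcases hG.offCircle_of_six_le (by omega) hx with h | h
    · exact x0 h
    · exact x1 h
  obtain rfl | rfl | rfl | rfl : n = 2 ∨ n = 3 ∨ n = 4 ∨ n = 5 := by omega
  · rcases hG.offCircle_of_two hx with h | h
    · exact absurd h x0
    · exact absurd h x1
  · have hc : Real.cos (Real.pi / (3 : ℕ)) = 1 / 2 := by rw [Nat.cast_ofNat, Real.cos_pi_div_three]
    refine key quatS' (by rw [hc]; rfl) ?_ IsADE.E6 unitI_quatJ_mem_E6.2
      (hG.exists_pair_three hx x0 x1) fun K _ h1 h2 => le_closure_E6 h1 (by rwa [hc] at h2)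
    simp [quatS, quatS', coe_unitQuat]; norm_num
  · have hc : Real.cos (Real.pi / (4 : ℕ)) = √2 / 2 := by
      rw [Nat.cast_ofNat, Real.cos_pi_div_four]
    refine key quatO ?_ ?_ IsADE.E7 unitI_quatJ_mem_E7.2
      (hG.exists_pair_four hx x0 x1) fun K _ h1 h2 => le_closure_E7 h1 (by rwa [hc] at h2)
    · rw [hc]
      change 1 / √2 = √2 / 2
      rw [div_eq_div_iff (by positivity) two_ne_zero, Real.mul_self_sqrt zero_le_two, one_mul]
    · simp [quatS, quatO, coe_unitQuat]
  · have hc := cos_pi_div_five_cast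
    refine key quatI (by rw [hc]; rfl) ?_ IsADE.E8 unitI_quatJ_mem_E8.2
      (hG.exists_pair_five hx x0 x1) fun K _ h1 h2 => le_closure_E8 h1 (by rwa [hc] at h2)
    simp only [coe_mul_Sp1, Quaternion.re_mul, quatS, quatI, coe_unitQuat, quat_re, quat_imI,
      quat_imJ, quat_imK, inv_goldenRatio_eq]
    ring

/-- The finite subgroups of the unit quaternions: each nontrivial one is conjugate to an ADE
subgroup. -/
theorem exists_conj_isADE (G : Subgroup Sp1) [Finite G] (hne : G ≠ ⊥) :
    ∃ h : Sp1, IsADE (MulAut.conj h • G) := by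
  -- the group `±G`
  let G' : Subgroup Sp1 :=
    { carrier := {x | x ∈ G ∨ -x ∈ G}
      one_mem' := Or.inl G.one_mem
      mul_mem' := by
        rintro x y (hx | hx) (hy | hy)
        · exact Or.inl (mul_mem hx hy)
        · exact Or.inr (by simpa using mul_mem hx hy)
        · exact Or.inr (by simpa using mul_mem hx hy)
        · exact Or.inl (by simpa using mul_mem hx hy)
      inv_mem' := by
        rintro x (hx | hx)
        · exact Or.inl (inv_mem hx)
        · exact Or.inr (by simpa using inv_mem hx) }
  have hle : G ≤ G' := fun x hx => Or.inl hx
  have hneg : -1 ∈ G' := Or.inr (by simp [G.one_mem])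
  have hfin : Finite G' := by
    have h1 : (G : Set Sp1).Finite := Set.toFinite _
    exact (h1.union (h1.preimage neg_injective.injOn)).to_subtype
  rcases circle_or_isADE_of_neg_one_mem G' hneg with ⟨h, hh⟩ | ⟨⟨h, hh⟩, x, hx, hxx⟩
  · refine ⟨h, eq_closure_of_le_circle _ (fun x hx => hh x ?_) fun e => hne ?_⟩
    · exact mem_conj_smul.mpr (hle (mem_conj_smul.mp hx))
    · rw [eq_bot_iff]
      intro x hx
      have : h * x * h⁻¹ ∈ MulAut.conj h • G := mem_conj_smul.mpr (by simpa [mul_assoc] using hx)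
      rw [e, Subgroup.mem_bot, mul_inv_eq_one, mul_eq_left] at this
      exact this
  · -- a square root of `-1`, up to sign in `G`, shows `-1 ∈ G`, so that `G` and `±G` agree
    have hG : -1 ∈ G := by
      rcases hx with hx | hx
      · rw [← hxx]; exact mul_mem hx hx
      · rw [← hxx, ← neg_mul_neg]; exact mul_mem hx hx
    have : G' = G := le_antisymm (fun y hy => by
      rcases hy with hy | hy
      · exact hy
      · have := mul_mem hG hy
        simpa using this) hle
    exact ⟨h, this ▸ hh⟩

/-! ### Killing spinors -/

/-- Orthogonal vectors anticommute in the Clifford algebra. -/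
theorem cliff_anticomm {v w : E5} (h : inner ℝ v w = 0) :
    cliff v * cliff w + cliff w * cliff v = 0 := by
  have h1 := cliff_sq (v + w)
  rw [cliff_add, norm_add_sq_real, h, mul_zero, add_zero, add_smul, ← cliff_sq, ← cliff_sq,
    add_mul, mul_add, mul_add] at h1
  have h2 : cliff v * cliff w + cliff w * cliff v =
      (cliff v * cliff v + cliff v * cliff w + (cliff w * cliff v + cliff w * cliff w)) -
        (cliff v * cliff v + cliff w * cliff w) := by abel
  rw [h2, h1, sub_self]

theorem cliff_mulVec_cliff_mulVec (x : S4) (s : Spinor) : cliff x.1 *ᵥ (cliff x.1 *ᵥ s) = s := by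
  rw [Matrix.mulVec_mulVec, cliff_sq, mem_sphere_zero_iff_norm.mp x.2, one_pow, one_smul,
    Matrix.one_mulVec]

theorem radialExt_coe (ψ : S4 → Spinor) (x : S4) : radialExt ψ x.1 = ψ x := by
  have hx : x.1 ≠ 0 := ne_zero_of_mem_unit_sphere x
  rw [radialExt, dif_neg hx]
  congr 1
  apply Subtype.ext
  change ‖x.1‖⁻¹ • x.1 = x.1
  rw [mem_sphere_zero_iff_norm.mp x.2, inv_one, one_smul]

/-- Clifford multiplication as a real bilinear map. -/
noncomputable def cliffBilin : E5 →ₗ[ℝ] Spinor →ₗ[ℝ] Spinor :=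
  LinearMap.mk₂ ℝ (fun x s => cliff x *ᵥ s)
    (fun x y s => by rw [cliff_add, Matrix.add_mulVec])
    (fun c x s => by rw [cliff_smul, Matrix.smul_mulVec])
    (fun x s t => Matrix.mulVec_add _ _ _)
    (fun c x s => Matrix.mulVec_smul _ _ _)

/-- Leibniz rule for Clifford multiplication along a curve. -/
theorem hasDerivAt_cliff_mulVec {γ : ℝ → E5} {γ' : E5} {g : ℝ → Spinor} {g' : Spinor} {t : ℝ}
    (hγ : HasDerivAt γ γ' t) (hg : HasDerivAt g g' t) :
    HasDerivAt (fun t => cliff (γ t) *ᵥ g t) (cliff γ' *ᵥ g t + cliff (γ t) *ᵥ g') t := by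
  rw [add_comm]
  exact (LinearMap.toContinuousBilinearMap cliffBilin).hasDerivAt_of_bilinear
    (fun _ => hγ) (fun _ => hg)

/-- The great circle from `x` in the direction of the unit tangent vector `v`. -/
noncomputable def greatCircle (x : S4) (v : E5) (hv : ‖v‖ = 1) (h : inner ℝ x.1 v = 0) (t : ℝ) :
    S4 :=
  ⟨Real.cos t • x.1 + Real.sin t • v, by
    have hx := mem_sphere_zero_iff_norm.mp x.2
    rw [mem_sphere_zero_iff_norm, ← sq_eq_sq₀ (norm_nonneg _) zero_le_one, norm_add_sq_real,
      norm_smul, norm_smul, hx, hv, inner_smul_left, inner_smul_right, h]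
    simp [Real.cos_sq_add_sin_sq]⟩

theorem hasDerivAt_greatCircle (x : S4) (v : E5) (hv : ‖v‖ = 1) (h : inner ℝ x.1 v = 0) (t : ℝ) :
    HasDerivAt (fun t => (greatCircle x v hv h t).1) (-Real.sin t • x.1 + Real.cos t • v) t :=
  ((Real.hasDerivAt_cos t).smul_const x.1).add ((Real.hasDerivAt_sin t).smul_const v)

theorem inner_greatCircle_deriv (x : S4) (v : E5) (hv : ‖v‖ = 1) (h : inner ℝ x.1 v = 0) (t : ℝ) :
    inner ℝ (greatCircle x v hv h t).1 (-Real.sin t • x.1 + Real.cos t • v) = 0 := by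
  have hx := mem_sphere_zero_iff_norm.mp x.2
  have h' : inner ℝ v x.1 = 0 := by rw [real_inner_comm, h]
  simp only [greatCircle, inner_add_left, inner_add_right, inner_smul_left, inner_smul_right,
    h, h', real_inner_self_eq_norm_sq, hx, hv]
  simp
  ring

theorem exists_orthogonal (x : S4) : ∃ w : E5, w ≠ 0 ∧ inner ℝ x.1 w = 0 := by
  by_cases hq : x.1.snd = 0
  · refine ⟨WithLp.toLp 2 (0, 1), fun h => ?_, ?_⟩
    · have := congrArg (fun v : E5 => v.snd) h
      simp at this
    · simp [WithLp.prod_inner_apply, hq]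
  · refine ⟨WithLp.toLp 2 (0, x.1.snd * quat 0 1 0 0), fun h => ?_, ?_⟩
    · have := congrArg (fun v : E5 => v.snd) h
      have h1 : quat 0 1 0 0 = 0 := by simpa [hq] using this
      exact one_ne_zero (congrArg QuaternionAlgebra.imI h1)
    · simp [WithLp.prod_inner_apply, Quaternion.inner_def]
      ring

/-- Any two points of the sphere lie on a great circle. -/
theorem exists_greatCircle (x y : S4) :
    ∃ (v : E5) (hv : ‖v‖ = 1) (h : inner ℝ x.1 v = 0) (t : ℝ), greatCircle x v hv h t = y := by
  have hx := mem_sphere_zero_iff_norm.mp x.2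
  have hy := mem_sphere_zero_iff_norm.mp y.2
  obtain ⟨c, hc⟩ : ∃ c : ℝ, c = inner ℝ x.1 y.1 := ⟨_, rfl⟩
  obtain ⟨w, hw⟩ : ∃ w, w = y.1 - c • x.1 := ⟨_, rfl⟩
  have hxw : inner ℝ x.1 w = 0 := by
    rw [hw, inner_sub_right, inner_smul_right, real_inner_self_eq_norm_sq, hx, ← hc]; ring
  have hn : c ^ 2 + ‖w‖ ^ 2 = 1 := by
    have : y.1 = c • x.1 + w := by rw [hw]; abel
    have h2 := norm_add_sq_real (c • x.1) w
    rw [← this, hy, norm_smul, hx, inner_smul_left, hxw] at h2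
    simp at h2
    linarith
  have hc1 : -1 ≤ c ∧ c ≤ 1 := abs_le.mp ((sq_le_one_iff_abs_le_one c).mp
    (by nlinarith [sq_nonneg ‖w‖]))
  have hcos := Real.cos_arccos hc1.1 hc1.2
  have hsin : Real.sin (Real.arccos c) = ‖w‖ := by
    rw [Real.sin_arccos, show 1 - c ^ 2 = ‖w‖ ^ 2 by linarith, Real.sqrt_sq (norm_nonneg _)]
  have unit : ∀ u : E5, u ≠ 0 → inner ℝ x.1 u = 0 →
      ‖(‖u‖⁻¹ : ℝ) • u‖ = 1 ∧ inner ℝ x.1 ((‖u‖⁻¹ : ℝ) • u) = 0 := fun u hu h =>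
    ⟨by rw [norm_smul, norm_inv, norm_norm, inv_mul_cancel₀ (norm_ne_zero_iff.mpr hu)],
      by rw [inner_smul_right, h, mul_zero]⟩
  by_cases h0 : w = 0
  · obtain ⟨u, hu, hxu⟩ := exists_orthogonal x
    obtain ⟨h1, h2⟩ := unit u hu hxu
    refine ⟨_, h1, h2, Real.arccos c, Subtype.ext ?_⟩
    change Real.cos _ • x.1 + Real.sin _ • _ = y.1
    rw [hcos, hsin, h0, norm_zero, zero_smul, add_zero]
    rw [h0] at hw
    exact (sub_eq_zero.mp hw.symm).symm
  · obtain ⟨h1, h2⟩ := unit w h0 hxw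
    refine ⟨_, h1, h2, Real.arccos c, Subtype.ext ?_⟩
    change Real.cos _ • x.1 + Real.sin _ • _ = y.1
    rw [hcos, hsin, smul_smul, mul_inv_cancel₀ (norm_ne_zero_iff.mpr h0), one_smul, hw]
    abel

/-- The spinor field determined by `s ∈ Δ`: the constant field `s` for `κ = -1/2` and
`x ↦ cliff x s` for `κ = 1/2`. -/
noncomputable def killingField (κ : ℝ) : Spinor →ₗ[ℝ] (S4 → Spinor) where
  toFun s x := if κ = 1 / 2 then cliff x.1 *ᵥ s else s
  map_add' s t := by
    funext x
    simp only [Pi.add_apply]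
    split_ifs <;> simp only [Matrix.mulVec_add]
  map_smul' c s := by
    funext x
    simp only [Pi.smul_apply, RingHom.id_apply]
    split_ifs <;> simp only [Matrix.mulVec_smul]

theorem killingField_half (s : Spinor) (x : S4) :
    killingField (1 / 2) s x = cliff x.1 *ᵥ s := if_pos rfl

theorem killingField_of_ne {κ : ℝ} (h : κ ≠ 1 / 2) (s : Spinor) (x : S4) :
    killingField κ s x = s := if_neg h

theorem killingField_neg_half (s : Spinor) (x : S4) :
    killingField (-1 / 2) s x = s := if_neg (by norm_num)

theorem killingField_apply_injective (κ : ℝ) (x : S4) {s t : Spinor}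
    (h : killingField κ s x = killingField κ t x) : s = t := by
  by_cases hκ : κ = 1 / 2
  · subst hκ
    rw [killingField_half, killingField_half] at h
    rw [← cliff_mulVec_cliff_mulVec x s, h, cliff_mulVec_cliff_mulVec]
  · rwa [killingField_of_ne hκ, killingField_of_ne hκ] at h

instance nonempty_S4 : Nonempty S4 :=
  ⟨⟨WithLp.toLp 2 (1, 0), by
    rw [mem_sphere_zero_iff_norm, ← sq_eq_sq₀ (norm_nonneg _) zero_le_one,
      WithLp.prod_norm_sq_eq_of_L2]
    simp⟩⟩

theorem killingField_injective (κ : ℝ) : Function.Injective (killingField κ) := fun _ _ h =>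
  killingField_apply_injective κ (Classical.arbitrary S4) (congrFun h _)

theorem IsKillingSpinor.hasDerivAt_greatCircle {κ : ℝ} {ψ : S4 → Spinor}
    (hψ : IsKillingSpinor κ ψ) (x : S4) (v : E5) (hv : ‖v‖ = 1) (h : inner ℝ x.1 v = 0) (t : ℝ) :
    HasDerivAt (fun t => ψ (greatCircle x v hv h t))
      ((κ + 1 / 2) • (cliff (-Real.sin t • x.1 + Real.cos t • v) *ᵥ
        (cliff (greatCircle x v hv h t).1 *ᵥ ψ (greatCircle x v hv h t)))) t := by
  have h1 := (hψ.1.differentiableAt (greatCircle x v hv h t)).hasFDerivAt.comp_hasDerivAt t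
    (M5.hasDerivAt_greatCircle x v hv h t)
  have h2 := hψ.2 _ _ (inner_greatCircle_deriv x v hv h t)
  rw [spinCovDeriv, sub_eq_iff_eq_add, ← add_smul] at h2
  rw [h2] at h1
  refine h1.congr_of_eventuallyEq (Filter.Eventually.of_forall fun s => ?_)
  exact (radialExt_coe ψ _).symm

/-- A Killing spinor with constant `1/2` becomes constant after Clifford multiplication by the
position vector; one with constant `-1/2` is constant. -/
theorem IsKillingSpinor.eq_killingField {κ : ℝ} (hκ : κ = 1 / 2 ∨ κ = -1 / 2) {ψ : S4 → Spinor}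
    (hψ : IsKillingSpinor κ ψ) : ∃ s, killingField κ s = ψ := by
  obtain ⟨x⟩ := nonempty_S4
  have const : ∀ {F : ℝ → Spinor}, (∀ t, HasDerivAt F 0 t) → ∀ t, F t = F 0 := fun {F} hF t =>
    is_const_of_deriv_eq_zero (fun t => (hF t).differentiableAt) (fun t => (hF t).deriv) t 0
  rcases hκ with rfl | rfl
  · refine ⟨cliff x.1 *ᵥ ψ x, funext fun y => ?_⟩
    obtain ⟨v, hv, h, t, rfl⟩ := exists_greatCircle x y
    have h0 : greatCircle x v hv h 0 = x := Subtype.ext (by simp [greatCircle])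
    have key := const (F := fun t => cliff (greatCircle x v hv h t).1 *ᵥ
      ψ (greatCircle x v hv h t)) (fun t => by
        have h1 := hasDerivAt_cliff_mulVec (M5.hasDerivAt_greatCircle x v hv h t)
          (hψ.hasDerivAt_greatCircle x v hv h t)
        convert h1 using 1
        have h2 := cliff_anticomm (inner_greatCircle_deriv x v hv h t)
        generalize -Real.sin t • x.1 + Real.cos t • v = X at *
        rw [show (1 / 2 + 1 / 2 : ℝ) = 1 by norm_num, one_smul, Matrix.mulVec_mulVec _ (cliff _),
          eq_neg_of_add_eq_zero_left h2, Matrix.neg_mulVec, ← Matrix.mulVec_mulVec,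
          cliff_mulVec_cliff_mulVec, add_neg_cancel]) t
    simp only [h0] at key
    rw [killingField_half, ← key, cliff_mulVec_cliff_mulVec]
  · refine ⟨ψ x, funext fun y => ?_⟩
    obtain ⟨v, hv, h, t, rfl⟩ := exists_greatCircle x y
    have h0 : greatCircle x v hv h 0 = x := Subtype.ext (by simp [greatCircle])
    have key := const (F := fun t => ψ (greatCircle x v hv h t)) (fun t => by
        have h1 := hψ.hasDerivAt_greatCircle x v hv h t
        rwa [show (-1 / 2 + 1 / 2 : ℝ) = 0 by norm_num, zero_smul] at h1) t
    simp only [h0] at key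
    rw [killingField_neg_half, key]

theorem isKillingSpinor_killingField {κ : ℝ} (hκ : κ = 1 / 2 ∨ κ = -1 / 2) (s : Spinor) :
    IsKillingSpinor κ (killingField κ s) := by
  rcases hκ with rfl | rfl
  · have hext : radialExt (killingField (1 / 2) s) = fun x => ‖x‖⁻¹ • cliffBilin.flip s x := by
      funext x
      by_cases hx : x = 0
      · simp [radialExt, hx]
      · rw [radialExt, dif_neg hx, killingField_half, ← map_smul]
        rfl
    have hsm : IsSmoothSpinor (killingField (1 / 2) s) := by
      rw [IsSmoothSpinor, hext]
      intro x hx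
      apply ContDiffAt.contDiffWithinAt
      exact ((contDiffAt_norm ℝ hx).inv (norm_ne_zero_iff.mpr hx)).smul
        (LinearMap.toContinuousLinearMap (cliffBilin.flip s)).contDiff.contDiffAt
    refine ⟨hsm, fun x X hX => ?_⟩
    -- differentiate along the great circle in the direction of `X`
    have hd : fderiv ℝ (radialExt (killingField (1 / 2) s)) x.1 X = cliff X *ᵥ s := by
      by_cases hX0 : X = 0
      · have := map_zero (cliffBilin.flip s)
        rw [hX0, map_zero]; exact this.symm
      have hn := norm_ne_zero_iff.mpr hX0
      have hv : ‖(‖X‖⁻¹ : ℝ) • X‖ = 1 := by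
        rw [norm_smul, norm_inv, norm_norm, inv_mul_cancel₀ hn]
      have hxv : inner ℝ x.1 ((‖X‖⁻¹ : ℝ) • X) = 0 := by rw [inner_smul_right, hX, mul_zero]
      have hXv : X = ‖X‖ • (‖X‖⁻¹ : ℝ) • X := by rw [smul_smul, mul_inv_cancel₀ hn, one_smul]
      generalize (‖X‖⁻¹ : ℝ) • X = v at *
      have h0 : greatCircle x v hv hxv 0 = x := Subtype.ext (by simp [greatCircle])
      have c1 := M5.hasDerivAt_greatCircle x v hv hxv 0
      have hfd := (hsm.differentiableAt (greatCircle x v hv hxv 0)).hasFDerivAt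
      have c2 := hfd.comp_hasDerivAt 0 c1
      have c3 := hasDerivAt_cliff_mulVec c1 (hasDerivAt_const 0 s)
      have c4 := c2.unique (c3.congr_of_eventuallyEq (Filter.Eventually.of_forall fun t => by
        change radialExt _ (greatCircle x v hv hxv t).1 = _
        rw [radialExt_coe, killingField_half]))
      simp only [h0, Real.sin_zero, Real.cos_zero, neg_zero, zero_smul, zero_add, one_smul,
        Matrix.mulVec_zero, add_zero] at c4
      rw [hXv, map_smul, c4, cliff_smul, Matrix.smul_mulVec]
    rw [spinCovDeriv, hd, sphereCliff, killingField_half, cliff_mulVec_cliff_mulVec]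
    module
  · have hext : ∀ x : E5, x ≠ 0 → radialExt (killingField (-1 / 2) s) x = s := fun x hx => by
      rw [radialExt, dif_neg hx, killingField_neg_half]
    refine ⟨(contDiffOn_const (c := s)).congr hext, fun x X hX => ?_⟩
    have hx : x.1 ≠ 0 := ne_zero_of_mem_unit_sphere x
    have he : radialExt (killingField (-1 / 2) s) =ᶠ[nhds x.1] fun _ => s :=
      Filter.eventually_of_mem (isOpen_compl_singleton.mem_nhds hx) hext
    rw [spinCovDeriv, he.fderiv_eq, fderiv_const_apply]
    simp only [zero_apply, zero_sub, neg_div, neg_smul]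

theorem killingSpinors_eq_range {κ : ℝ} (hκ : κ = 1 / 2 ∨ κ = -1 / 2) :
    killingSpinors κ = (killingField κ).range := by
  ext ψ
  constructor
  · exact fun h => IsKillingSpinor.eq_killingField hκ h
  · rintro ⟨s, rfl⟩
    exact isKillingSpinor_killingField hκ s

/-- The parametrisation of Killing spinors by `Δ` is `Sp(2)`-equivariant. -/
theorem killingField_sphereAct_iff (κ : ℝ) (g : Sp2) (x : S4) (s t : Spinor) :
    killingField κ t (sphereAct g x) = g.1 *ᵥ killingField κ s x ↔ t = g.1 *ᵥ s := by
  have key : killingField κ (g.1 *ᵥ s) (sphereAct g x) = g.1 *ᵥ killingField κ s x := by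
    by_cases hκ : κ = 1 / 2
    · subst hκ
      rw [killingField_half, killingField_half]
      change cliff (rhoFun g x.1) *ᵥ _ = _
      rw [cliff_rhoFun, Matrix.mulVec_mulVec, mul_assoc, Unitary.star_mul_self_of_mem g.2, mul_one,
        Matrix.mulVec_mulVec]
    · rw [killingField_of_ne hκ, killingField_of_ne hκ]
  rw [← key]
  exact ⟨fun h => killingField_apply_injective κ _ h, fun h => by rw [h]⟩

theorem orbifoldKillingSpinors_eq_map {κ : ℝ} (hκ : κ = 1 / 2 ∨ κ = -1 / 2) (Γ : Subgroup Sp2) :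
    orbifoldKillingSpinors κ Γ = (invariantSpinors Γ).map (killingField κ) := by
  have inv_iff : ∀ s, (∀ γ ∈ Γ, ∀ x, killingField κ s (sphereAct γ x) =
      γ.1 *ᵥ killingField κ s x) ↔ s ∈ invariantSpinors Γ := fun s =>
    ⟨fun h γ hγ => ((killingField_sphereAct_iff κ γ (Classical.arbitrary S4) s s).mp
      (h γ hγ _)).symm, fun h γ hγ x => (killingField_sphereAct_iff κ γ x s s).mpr (h γ hγ).symm⟩
  ext ψ
  constructor
  · rintro ⟨h1, h2⟩
    obtain ⟨s, rfl⟩ := IsKillingSpinor.eq_killingField hκ h1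
    exact ⟨s, (inv_iff s).mp h2, rfl⟩
  · rintro ⟨s, hs, rfl⟩
    exact ⟨isKillingSpinor_killingField hκ s, (inv_iff s).mpr hs⟩

theorem finrank_orbifoldKillingSpinors {κ : ℝ} (hκ : κ = 1 / 2 ∨ κ = -1 / 2) (Γ : Subgroup Sp2) :
    Module.finrank ℝ (orbifoldKillingSpinors κ Γ) = Module.finrank ℝ (invariantSpinors Γ) := by
  rw [orbifoldKillingSpinors_eq_map hκ]
  exact (LinearEquiv.finrank_eq
    (Submodule.equivMapOfInjective _ (killingField_injective κ) _)).symm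

theorem finrank_spinor : Module.finrank ℝ Spinor = 8 := by
  rw [Module.finrank_pi_fintype]
  simp [Quaternion.finrank_eq_four]

theorem finrank_killingSpinors {κ : ℝ} (hκ : κ = 1 / 2 ∨ κ = -1 / 2) :
    Module.finrank ℝ (killingSpinors κ) = 8 := by
  rw [killingSpinors_eq_range hκ, LinearMap.finrank_range_of_inj (killingField_injective κ),
    finrank_spinor]

/-! ### Invariant spinors -/

/-- The invariant spinors as a right quaternionic subspace of `Δ`. -/
def invariantSubspace (Γ : Subgroup Sp2) : Submodule ℍ[ℝ]ᵐᵒᵖ Spinor where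
  carrier := invariantSpinors Γ
  zero_mem' := zero_mem _
  add_mem' := add_mem
  smul_mem' c s hs γ hγ := by rw [Matrix.mulVec_smul, hs γ hγ]

theorem finrank_mulOpposite : Module.finrank ℝ ℍ[ℝ]ᵐᵒᵖ = 4 := by
  rw [← Quaternion.finrank_eq_four (R := ℝ)]
  exact (LinearEquiv.finrank_eq (MulOpposite.opLinearEquiv ℝ)).symm

theorem finrank_spinor_quaternionic : Module.finrank ℍ[ℝ]ᵐᵒᵖ Spinor = 2 := by
  have h := Module.finrank_mul_finrank ℝ ℍ[ℝ]ᵐᵒᵖ Spinor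
  rw [finrank_mulOpposite, finrank_spinor] at h
  omega

instance finite_spinor_quaternionic : Module.Finite ℍ[ℝ]ᵐᵒᵖ Spinor :=
  Module.Finite.of_restrictScalars_finite ℝ _ _

theorem finrank_invariantSpinors (Γ : Subgroup Sp2) :
    Module.finrank ℝ (invariantSpinors Γ) =
      4 * Module.finrank ℍ[ℝ]ᵐᵒᵖ (invariantSubspace Γ) := by
  rw [← finrank_mulOpposite, Module.finrank_mul_finrank ℝ ℍ[ℝ]ᵐᵒᵖ (invariantSubspace Γ)]
  rfl

theorem finrank_invariantSubspace_le (Γ : Subgroup Sp2) :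
    Module.finrank ℍ[ℝ]ᵐᵒᵖ (invariantSubspace Γ) ≤ 2 :=
  (Submodule.finrank_le _).trans_eq finrank_spinor_quaternionic

theorem finrank_invariantSubspace_eq_two_iff (Γ : Subgroup Sp2) :
    Module.finrank ℍ[ℝ]ᵐᵒᵖ (invariantSubspace Γ) = 2 ↔ Γ = ⊥ := by
  constructor
  · intro h
    have htop : invariantSubspace Γ = ⊤ :=
      Submodule.eq_top_of_finrank_eq (h.trans finrank_spinor_quaternionic.symm)
    rw [eq_bot_iff]
    intro γ hγ
    rw [Subgroup.mem_bot]
    apply Subtype.ext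
    apply Matrix.ext_of_mulVec_single
    intro i
    have : Pi.single i 1 ∈ invariantSubspace Γ := htop ▸ Submodule.mem_top
    rw [this γ hγ, Submonoid.coe_one, Matrix.one_mulVec]
  · rintro rfl
    have htop : invariantSubspace ⊥ = ⊤ := by
      rw [eq_top_iff]
      rintro s - γ hγ
      rw [Subgroup.mem_bot.mp hγ, Submonoid.coe_one, Matrix.one_mulVec]
    rw [htop, finrank_top, finrank_spinor_quaternionic]

theorem isHalfBPS_iff_finrank {κ : ℝ} (hκ : κ = 1 / 2 ∨ κ = -1 / 2) (Γ : Subgroup Sp2) :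
    IsHalfBPS κ Γ ↔ Module.finrank ℍ[ℝ]ᵐᵒᵖ (invariantSubspace Γ) = 1 := by
  rw [IsHalfBPS, finrank_orbifoldKillingSpinors hκ, finrank_killingSpinors hκ,
    finrank_invariantSpinors]
  omega

/-- Half-BPS means that the invariant spinors are neither zero nor, as happens only for trivial `Γ`,
all of `Δ`. -/
theorem isHalfBPS_iff {κ : ℝ} (hκ : κ = 1 / 2 ∨ κ = -1 / 2) (Γ : Subgroup Sp2) :
    IsHalfBPS κ Γ ↔ Γ ≠ ⊥ ∧ ∃ s ∈ invariantSpinors Γ, s ≠ 0 := by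
  have h2 := finrank_invariantSubspace_le Γ
  have h3 : Module.finrank ℍ[ℝ]ᵐᵒᵖ (invariantSubspace Γ) ≠ 0 ↔
      ∃ s ∈ invariantSpinors Γ, s ≠ 0 := by
    rw [Ne, Submodule.finrank_eq_zero, ← Ne, Submodule.ne_bot_iff]
    rfl
  rw [isHalfBPS_iff_finrank hκ, Ne, ← finrank_invariantSubspace_eq_two_iff, ← h3]
  omega

theorem isSupersymmetric_iff {κ : ℝ} (hκ : κ = 1 / 2 ∨ κ = -1 / 2) (Γ : Subgroup Sp2) :
    IsSupersymmetric κ Γ ↔ ∃ s ∈ invariantSpinors Γ, s ≠ 0 := by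
  rw [IsSupersymmetric, orbifoldKillingSpinors_eq_map hκ, Ne,
    (Submodule.map_injective_of_injective (killingField_injective κ)).eq_iff' (Submodule.map_bot _),
    ← Ne,
    Submodule.ne_bot_iff]

theorem finrank_E5 : Module.finrank ℝ E5 = 5 := by
  rw [(WithLp.linearEquiv 2 ℝ (ℝ × ℍ[ℝ])).finrank_eq, Module.finrank_prod,
    Quaternion.finrank_eq_four, Module.finrank_self]

/-- If `Γ` acts trivially on `S⁴` it commutes with Clifford multiplication. An invariant spinor
`s ≠ 0` then gives a `5`-dimensional space of invariant spinors `cliff v s`, so all are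
invariant. -/
theorem eq_bot_of_sphereAct_trivial {Γ : Subgroup Sp2} {s : Spinor} (hs : s ∈ invariantSpinors Γ)
    (hs0 : s ≠ 0) (h : ∀ γ ∈ Γ, ∀ x, sphereAct γ x = x) : Γ = ⊥ := by
  have hle : (cliffBilin.flip s).range ≤ invariantSpinors Γ := by
    rintro _ ⟨v, rfl⟩ γ hγ
    have unit : ∀ x : S4, γ.1 *ᵥ (cliff x.1 *ᵥ s) = cliff x.1 *ᵥ s := by
      intro x
      have h1 : cliff x.1 = γ.1 * cliff x.1 * star γ.1 := by
        rw [← cliff_rhoFun]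
        exact congrArg (fun z : S4 => cliff z.1) (h γ hγ x).symm
      conv_rhs => rw [h1]
      rw [← Matrix.mulVec_mulVec, ← Matrix.mulVec_mulVec]
      congr 2
      conv_rhs => rw [← hs γ hγ]
      rw [Matrix.mulVec_mulVec, Unitary.star_mul_self_of_mem γ.2, Matrix.one_mulVec]
    by_cases hv : v = 0
    · rw [hv, map_zero, Matrix.mulVec_zero]
    · have hn := norm_ne_zero_iff.mpr hv
      have := unit ⟨‖v‖⁻¹ • v, by
        rw [mem_sphere_zero_iff_norm, norm_smul, norm_inv, norm_norm, inv_mul_cancel₀ hn]⟩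
      rw [cliff_smul, Matrix.smul_mulVec, Matrix.mulVec_smul] at this
      exact smul_right_injective _ (inv_ne_zero hn) this
  have hinj : Function.Injective (cliffBilin.flip s) := by
    rw [injective_iff_map_eq_zero]
    intro v hv
    have h1 : cliff v *ᵥ (cliff v *ᵥ s) = 0 := by
      change cliff v *ᵥ s = 0 at hv
      rw [hv, Matrix.mulVec_zero]
    rw [Matrix.mulVec_mulVec, cliff_sq, Matrix.smul_mulVec, Matrix.one_mulVec,
      smul_eq_zero_iff_left hs0] at h1
    simpa using h1
  have h5 := Submodule.finrank_mono hle
  rw [LinearMap.finrank_range_of_inj hinj, finrank_E5, finrank_invariantSpinors] at h5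
  have h2 := finrank_invariantSubspace_le Γ
  exact (finrank_invariantSubspace_eq_two_iff Γ).mp (by omega)

/-! ### The stabiliser of a spinor -/

/-- The element of `Sp(2)` with second column `(x, t)`, `t` real. -/
def columnUnitary (x : ℍ[ℝ]) (t : ℝ) (h : Quaternion.normSq x + t ^ 2 = 1) : Sp2 :=
  ⟨!![(t : ℍ[ℝ]), x; -star x, (t : ℍ[ℝ])], by
    have hx1 : x * star x = ((1 - t ^ 2 : ℝ) : ℍ[ℝ]) := by
      rw [Quaternion.self_mul_star]; congr 1; linarith
    have hx2 : star x * x = ((1 - t ^ 2 : ℝ) : ℍ[ℝ]) := by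
      rw [Quaternion.star_mul_self]; congr 1; linarith
    have ht : (t : ℍ[ℝ]) * t + ((1 - t ^ 2 : ℝ) : ℍ[ℝ]) = 1 := by
      rw [← Quaternion.coe_mul, ← Quaternion.coe_add, ← Quaternion.coe_one]; congr 1; ring
    have ht' : ((1 - t ^ 2 : ℝ) : ℍ[ℝ]) + (t : ℍ[ℝ]) * t = 1 := by rw [add_comm, ht]
    have hc := Quaternion.coe_commutes t x
    have hc' := Quaternion.coe_commutes t (star x)
    rw [Unitary.mem_iff]
    constructor <;> ext1 i j <;> fin_cases i <;> fin_cases j <;>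
      simp only [Matrix.mul_apply, Fin.sum_univ_two, Matrix.star_apply, Fin.zero_eta, Fin.mk_one,
        Matrix.of_apply, Matrix.cons_val', Matrix.cons_val_zero, Matrix.cons_val_one,
        Quaternion.star_coe, star_neg, star_star, neg_mul, mul_neg, neg_neg, hx1, hx2, ht, ht',
        hc, hc', Matrix.one_apply, if_true] <;> simp⟩

theorem columnUnitary_mulVec (x : ℍ[ℝ]) (t : ℝ) (h) :
    (columnUnitary x t h).1 *ᵥ ![0, 1] = ![x, (t : ℍ[ℝ])] := by
  funext i
  fin_cases i <;> simp [columnUnitary, Matrix.mulVec, dotProduct, Fin.sum_univ_two]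

/-- `Sp(2)` acts transitively on the quaternionic lines in `Δ`. -/
theorem exists_mulVec_eq_smul {s : Spinor} (hs : s ≠ 0) :
    ∃ (g : Sp2) (q : ℍ[ℝ]), g.1 *ᵥ ![0, 1] = MulOpposite.op q • s := by
  by_cases h1 : s 1 = 0
  · have h0 : s 0 ≠ 0 := fun h0 => hs (by funext i; fin_cases i <;> simp [h0, h1])
    obtain ⟨u, r, -, hu⟩ := exists_unit_smul h0
    have hn : Quaternion.normSq u.1 + (0 : ℝ) ^ 2 = 1 := by
      have := sum_sq_Sp1 u
      rw [Quaternion.normSq_def']; linarith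
    refine ⟨columnUnitary u.1 0 hn, (r : ℍ[ℝ]), ?_⟩
    rw [columnUnitary_mulVec]
    funext i
    fin_cases i
    · simp [hu, Quaternion.mul_coe_eq_smul]
    · simp [h1]
  · obtain ⟨z, hz⟩ : ∃ z, z = s 0 * (s 1)⁻¹ := ⟨_, rfl⟩
    have hpos : 0 < 1 + Quaternion.normSq z := by
      have := Quaternion.normSq_nonneg (a := z)
      linarith
    obtain ⟨t, ht⟩ : ∃ t : ℝ, t ^ 2 * (1 + Quaternion.normSq z) = 1 :=
      ⟨(√(1 + Quaternion.normSq z))⁻¹, by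
        rw [inv_pow, Real.sq_sqrt hpos.le, inv_mul_cancel₀ hpos.ne']⟩
    have hn : Quaternion.normSq (z * (t : ℍ[ℝ])) + t ^ 2 = 1 := by
      rw [map_mul, Quaternion.normSq_coe]; linarith
    refine ⟨columnUnitary (z * (t : ℍ[ℝ])) t hn, (s 1)⁻¹ * t, ?_⟩
    rw [columnUnitary_mulVec]
    funext i
    fin_cases i
    · simp [hz, mul_assoc]
    · simp [h1]

/-- The stabiliser of the spinor `(0, 1)` is the embedded `Sp(1)`. -/
theorem exists_embed_eq {g : Sp2} (hg : g.1 *ᵥ ![0, 1] = ![0, 1]) : ∃ u, embed u = g := by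
  have hg' : star g.1 *ᵥ ![0, 1] = ![0, 1] := by
    conv_lhs => rw [← hg]
    rw [Matrix.mulVec_mulVec, Unitary.star_mul_self_of_mem g.2, Matrix.one_mulVec]
  have e01 : g.1 0 1 = 0 := by
    simpa [Matrix.mulVec, dotProduct, Fin.sum_univ_two] using congrFun hg 0
  have e11 : g.1 1 1 = 1 := by
    simpa [Matrix.mulVec, dotProduct, Fin.sum_univ_two] using congrFun hg 1
  have e10 : g.1 1 0 = 0 := by
    simpa [Matrix.mulVec, dotProduct, Fin.sum_univ_two, Matrix.star_apply] using congrFun hg' 0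
  have u1 : (star g.1 * g.1) 0 0 = (1 : Matrix (Fin 2) (Fin 2) ℍ[ℝ]) 0 0 := by
    rw [Unitary.star_mul_self_of_mem g.2]
  have u2 : (g.1 * star g.1) 0 0 = (1 : Matrix (Fin 2) (Fin 2) ℍ[ℝ]) 0 0 := by
    rw [Unitary.mul_star_self_of_mem g.2]
  rw [Matrix.mul_apply, Fin.sum_univ_two, Matrix.star_apply, Matrix.star_apply, e10, mul_zero,
    add_zero, Matrix.one_apply_eq] at u1
  rw [Matrix.mul_apply, Fin.sum_univ_two, Matrix.star_apply, Matrix.star_apply, e01, zero_mul,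
    add_zero, Matrix.one_apply_eq] at u2
  refine ⟨⟨g.1 0 0, Unitary.mem_iff.mpr ⟨u1, u2⟩⟩, Subtype.ext ?_⟩
  ext1 i j
  fin_cases i <;> fin_cases j <;> simp [embed, e01, e10, e11]

theorem embed_mulVec (u : Sp1) (x y : ℍ[ℝ]) : (embed u).1 *ᵥ ![x, y] = ![u.1 * x, y] := by
  funext i
  fin_cases i <;> simp [embed, Matrix.mulVec_diagonal]

theorem embed_injective : Function.Injective embed := fun u v h => by
  have := congrArg (fun g : Sp2 => g.1 0 0) h
  exact Subtype.ext (by simpa [embed] using this)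

/-- The embedded `Sp(1)` acts on `ℝ⁵ = ℝ ⊕ ℍ` by left multiplication on `ℍ`. -/
theorem rho_embed (u : Sp1) (r : ℝ) (q : ℍ[ℝ]) :
    rho (embed u) (WithLp.toLp 2 (r, q)) = WithLp.toLp 2 (r, u.1 * q) := by
  apply cliff_injective
  change cliff (rhoFun _ _) = _
  have hu := Unitary.mul_star_self_of_mem u.2
  have hr : u.1 * (r : ℍ[ℝ]) * star u.1 = r := by
    rw [← Quaternion.coe_commutes, mul_assoc, hu, mul_one]
  rw [cliff_rhoFun]
  ext1 i j
  fin_cases i <;> fin_cases j <;>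
    simp [embed, cliff, Matrix.star_eq_conjTranspose, Matrix.diagonal_conjTranspose, hr]

/-! ### ADE subgroups and half-BPS orbifolds -/

theorem IsADE.ne_bot {A : Subgroup Sp1} (hA : IsADE A) : A ≠ ⊥ := by
  have key : ∀ {x : Sp1}, x ∈ A → x.1.re < 1 → A ≠ ⊥ := by
    rintro x hx hlt rfl
    rw [Subgroup.mem_bot.mp hx, Submonoid.coe_one, Quaternion.re_one] at hlt
    exact lt_irrefl _ hlt
  cases hA with
  | A n hn =>
    refine key (Subgroup.subset_closure (Set.mem_singleton _)) ?_
    change Real.cos (2 * Real.pi / n) < 1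
    have hn' : (2 : ℝ) ≤ n := by exact_mod_cast hn
    have hpi := Real.pi_pos
    rw [← Real.cos_zero]
    apply Real.cos_lt_cos_of_nonneg_of_le_pi le_rfl
    · rw [div_le_iff₀ (by linarith)]; nlinarith
    · positivity
  | D n hn => exact key (Subgroup.subset_closure (Set.mem_insert _ _)) zero_lt_one
  | E6 => exact key (Subgroup.subset_closure (Set.mem_insert _ _)) one_half_lt_one
  | E7 => exact key (Subgroup.subset_closure (Set.mem_insert _ _)) one_half_lt_one
  | E8 => exact key (Subgroup.subset_closure (Set.mem_insert _ _)) one_half_lt_one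

theorem isHalfBPS_of_conj {κ : ℝ} (hκ : κ = 1 / 2 ∨ κ = -1 / 2) {A : Subgroup Sp1} (hA : A ≠ ⊥)
    (g : Sp2) : IsHalfBPS κ ((A.map embed).map (MulAut.conj g).toMonoidHom) := by
  rw [isHalfBPS_iff hκ]
  constructor
  · rw [Ne, Subgroup.map_eq_bot_iff_of_injective _ (MulAut.conj g).injective,
      Subgroup.map_eq_bot_iff_of_injective _ embed_injective]
    exact hA
  · refine ⟨g.1 *ᵥ ![0, 1], ?_, fun h => ?_⟩
    · rintro _ ⟨_, ⟨u, -, rfl⟩, rfl⟩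
      change (g * embed u * g⁻¹).1 *ᵥ _ = _
      rw [Matrix.mulVec_mulVec, ← Submonoid.coe_mul, inv_mul_cancel_right, Submonoid.coe_mul,
        ← Matrix.mulVec_mulVec, embed_mulVec, mul_zero]
    · have h1 : star g.1 *ᵥ (g.1 *ᵥ ![0, 1]) = 0 := by rw [h, Matrix.mulVec_zero]
      rw [Matrix.mulVec_mulVec, Unitary.star_mul_self_of_mem g.2, Matrix.one_mulVec] at h1
      exact one_ne_zero (congrFun h1 1)

/-- A finite group with an invariant spinor is conjugate to a subgroup of the embedded `Sp(1)`. -/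
theorem exists_eq_conj_embed {Γ : Subgroup Sp2} {s : Spinor} (hs : s ∈ invariantSpinors Γ)
    (hs0 : s ≠ 0) :
    ∃ (A : Subgroup Sp1) (g : Sp2), Γ = (A.map embed).map (MulAut.conj g).toMonoidHom := by
  obtain ⟨g, q, hg⟩ := exists_mulVec_eq_smul hs0
  have hfix : ∀ γ ∈ Γ, γ.1 *ᵥ (g.1 *ᵥ ![0, 1]) = g.1 *ᵥ ![0, 1] := fun γ hγ => by
    rw [hg]; exact (invariantSubspace Γ).smul_mem (MulOpposite.op q) hs γ hγ
  refine ⟨(Γ.comap (MulAut.conj g).toMonoidHom).comap embed, g, ?_⟩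
  ext γ
  constructor
  · intro hγ
    obtain ⟨u, hu⟩ := exists_embed_eq (g := g⁻¹ * γ * g) (by
      rw [Submonoid.coe_mul, Submonoid.coe_mul, ← Matrix.mulVec_mulVec, ← Matrix.mulVec_mulVec,
        hfix γ hγ, Matrix.mulVec_mulVec, ← Submonoid.coe_mul, inv_mul_cancel, Submonoid.coe_one,
        Matrix.one_mulVec])
    have e : g * embed u * g⁻¹ = γ := by rw [hu]; group
    refine ⟨embed u, ⟨u, ?_, rfl⟩, e⟩
    change g * embed u * g⁻¹ ∈ Γ
    rwa [e]
  · rintro ⟨_, ⟨u, hu, rfl⟩, rfl⟩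
    exact hu

theorem isHalfBPS_iff_exists_isADE {κ : ℝ} (hκ : κ = 1 / 2 ∨ κ = -1 / 2) (Γ : Subgroup Sp2)
    [Finite Γ] : IsHalfBPS κ Γ ↔ ∃ A : Subgroup Sp1, IsADE A ∧
      ∃ g : Sp2, Γ = (A.map embed).map (MulAut.conj g).toMonoidHom := by
  constructor
  · intro h
    obtain ⟨hne, s, hs, hs0⟩ := (isHalfBPS_iff hκ Γ).mp h
    obtain ⟨A, g, rfl⟩ := exists_eq_conj_embed hs hs0
    have hfin : Finite A := by
      refine Finite.of_injective (fun a : A => (⟨_, ⟨_, ⟨a.1, a.2, rfl⟩, rfl⟩⟩ :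
        (A.map embed).map (MulAut.conj g).toMonoidHom)) fun a b e => ?_
      exact Subtype.ext (embed_injective ((MulAut.conj g).injective (congrArg Subtype.val e)))
    have hA : A ≠ ⊥ := fun hA => hne (by rw [hA, Subgroup.map_bot, Subgroup.map_bot])
    obtain ⟨h, hade⟩ := exists_conj_isADE A hA
    refine ⟨_, hade, g * (embed h)⁻¹, ?_⟩
    ext γ
    constructor
    · rintro ⟨_, ⟨a, ha, rfl⟩, rfl⟩
      refine ⟨_, ⟨h * a * h⁻¹, mem_conj_smul.mpr (by simpa [mul_assoc] using ha), rfl⟩, ?_⟩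
      change g * (embed h)⁻¹ * embed (h * a * h⁻¹) * (g * (embed h)⁻¹)⁻¹ = g * embed a * g⁻¹
      rw [map_mul, map_mul, map_inv]; group
    · rintro ⟨_, ⟨a, ha, rfl⟩, rfl⟩
      refine ⟨_, ⟨_, mem_conj_smul.mp ha, rfl⟩, ?_⟩
      change g * embed (h⁻¹ * a * h) * g⁻¹ = g * (embed h)⁻¹ * embed a * (g * (embed h)⁻¹)⁻¹
      rw [map_mul, map_mul, map_inv]; group
  · rintro ⟨A, hA, g, rfl⟩
    exact isHalfBPS_of_conj hκ hA.ne_bot g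

end M5

theorem mainTheorem10 (κ : ℝ) (hκ : κ = 1 / 2 ∨ κ = -1 / 2)
    (Γ : Subgroup M5.Sp2) [Finite Γ] :
    -- Killing spinors on the sphere are, equivariantly, the spinors in `Δ`
    (∃ e : M5.killingSpinors κ ≃ₗ[ℝ] M5.Spinor,
      ∀ (g : M5.Sp2) (ψ φ : M5.killingSpinors κ),
        (∀ x, φ.1 (M5.sphereAct g x) = g.1 *ᵥ ψ.1 x) → e φ = g.1 *ᵥ e ψ) ∧
    -- the invariant spinors form a quaternionic subspace `W` of the `2`-dimensional space `Δ`
    Module.finrank ℍ[ℝ]ᵐᵒᵖ M5.Spinor = 2 ∧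
    (∃ W : Submodule ℍ[ℝ]ᵐᵒᵖ M5.Spinor,
      (W : Set M5.Spinor) = M5.invariantSpinors Γ ∧
      Module.finrank ℝ (M5.orbifoldKillingSpinors κ Γ) = 4 * Module.finrank ℍ[ℝ]ᵐᵒᵖ W ∧
      (M5.IsHalfBPS κ Γ ↔ Module.finrank ℍ[ℝ]ᵐᵒᵖ W = 1)) ∧
    -- a supersymmetric orbifold is `S⁴` itself, and then `Γ` is trivial, or exactly half-BPS
    (M5.IsSupersymmetric κ Γ →
      ((∀ γ ∈ Γ, ∀ x, M5.sphereAct γ x = x) ↔ Γ = ⊥) ∧ (Γ ≠ ⊥ → M5.IsHalfBPS κ Γ)) ∧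
    -- the half-BPS orbifolds are those by conjugates of ADE subgroups
    (M5.IsHalfBPS κ Γ ↔
      ∃ A : Subgroup M5.Sp1, M5.IsADE A ∧
        ∃ g : M5.Sp2, Γ = (A.map M5.embed).map (MulAut.conj g).toMonoidHom) ∧
    -- the action of the embedded `Sp(1)` on `Δ` and on `ℝ⁵ = ℝ ⊕ ℍ`
    (∀ (u : M5.Sp1) (x y : ℍ[ℝ]), (M5.embed u).1 *ᵥ ![x, y] = ![u.1 * x, y]) ∧
    (∀ (u : M5.Sp1) (r : ℝ) (q : ℍ[ℝ]),
      M5.rho (M5.embed u) (WithLp.toLp 2 (r, q)) = WithLp.toLp 2 (r, u.1 * q)) := by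
  refine ⟨?_, M5.finrank_spinor_quaternionic,
    ⟨M5.invariantSubspace Γ, rfl, ?_, M5.isHalfBPS_iff_finrank hκ Γ⟩, fun h => ?_,
    M5.isHalfBPS_iff_exists_isADE hκ Γ, M5.embed_mulVec, M5.rho_embed⟩
  · refine ⟨((LinearEquiv.ofInjective _ (M5.killingField_injective κ)).trans
      (LinearEquiv.ofEq _ _ (M5.killingSpinors_eq_range hκ).symm)).symm, fun g ψ φ h => ?_⟩
    obtain ⟨s, rfl⟩ := ((LinearEquiv.ofInjective _ (M5.killingField_injective κ)).trans
      (LinearEquiv.ofEq _ _ (M5.killingSpinors_eq_range hκ).symm)).surjective ψ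
    obtain ⟨t, rfl⟩ := ((LinearEquiv.ofInjective _ (M5.killingField_injective κ)).trans
      (LinearEquiv.ofEq _ _ (M5.killingSpinors_eq_range hκ).symm)).surjective φ
    rw [LinearEquiv.symm_apply_apply, LinearEquiv.symm_apply_apply]
    exact (M5.killingField_sphereAct_iff κ g (Classical.arbitrary _) s t).mp (h _)
  · rw [M5.finrank_orbifoldKillingSpinors hκ, M5.finrank_invariantSpinors]
  · have hs := (M5.isSupersymmetric_iff hκ Γ).mp h
    refine ⟨⟨fun htriv => ?_, ?_⟩, fun hne => (M5.isHalfBPS_iff hκ Γ).mpr ⟨hne, hs⟩⟩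
    · obtain ⟨s, hs, hs0⟩ := hs
      exact M5.eq_bot_of_sphereAct_trivial hs hs0 htriv
    · rintro rfl γ hγ x
      rw [Subgroup.mem_bot.mp hγ]
      apply Subtype.ext
      change M5.rho 1 x.1 = x.1
      rw [map_one]; rfl
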